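/- $N$ objects appear in uniformly random order; at moment $n$ the $n$-th object appears, and its relative rank is its rank among the first $n$ objects. Let $u_N=0$, $u_n=\frac1{n+1}\max\{\frac{n+1}N,u_{n+1}\}+\frac n{n+1}u_{n+1}$ (the values of the classical secretary problem), and let $n^*$ be the smallest $n$ with $n/N\ge u_n$. Player 1 accepts the first object of relative rank 1 that appears at moment $n^*$ or later. Player 2 observes, in the same order, all objects except the one accepted by Player 1. He may accept one of them when it appears, and his payoff is 1 if it is the best of all $N$ objects and 0 otherwise. A candidate is an object that is the best of those seen so far by Player 2; the moments at which candidates appear are his decision points, and the decision of Player 2 whether to accept the current candidate is based on the list of his decision points so far. If a candidate appears at a moment $n>n^*$, then Player 1 has already accepted an object and the candidate has relative rank 1 or 2. Let $v(n,p)$ be the optimal expected payoff of Player 2 after he has rejected a candidate at moment $n>n^*$ which, given his history (the list of his decision points up to $n$), has relative rank 1 with probability $p$ and relative rank 2 with probability $1-p$; this is defined for every $p\in[0,1]$, and in the game itself $p$ is the posterior probability of relative rank 1 given the history. It depends on the history through $(n,p)$ only, and $v(n,0)$ is also the optimal future expected payoff of Player 2 when $n$ objects have appeared and Player 1 has accepted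 one of them, but Player 2 has not observed a candidate from moment $n^*$ to moment $n$. Let $v(n,-1)$ be the optimal future expected payoff of Player 2 when neither player has accepted any of the first $n$ objects. Theorem. For every $n$ with $n^*<n\le N$, the function $p\mapsto v(n,p)$ is non-decreasing on $[0,1]$. In addition, $v(n,-1)<v(n,0)$ for all $n$ with $n^*<n<N$. -/

import Mathlib

/-
The `N` objects appear in random order: `σ : Equiv.Perm (Fin N)` is uniformly distributed, the
object that appears at moment `i + 1` (`i : Fin N`) has absolute rank `σ i + 1`, so that smaller
values of `σ` are better and the best object is the one with `σ i = 0`.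
"The first `n` objects" are those with index `i < n`.
-/

/-- Player 1's optimal probability of selecting the best object when `m` objects are still to
appear, by dynamic programming: with `n = N - (m + 1)` objects already rejected it is
`(1 / (n + 1)) * max ((n + 1) / N) u + (n / (n + 1)) * u`, where `u` is the value with `n + 1`
objects rejected. -/
noncomputable def secretaryRem (N : ℕ) : ℕ → ℝ
  | 0 => 0
  | m + 1 =>
    (1 / (((N - (m + 1) : ℕ) : ℝ) + 1)) *
        max ((((N - (m + 1) : ℕ) : ℝ) + 1) / N) (secretaryRem N m) +
      (((N - (m + 1) : ℕ) : ℝ) / (((N - (m + 1) : ℕ) : ℝ) + 1)) * secretaryRem N m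

/-- `u_n`, `0 ≤ n ≤ N`: the optimal value of the classical secretary problem after the first `n`
objects have been rejected. -/
noncomputable def secretaryValue (N n : ℕ) : ℝ := secretaryRem N (N - n)

/-- `n*`: the smallest `n` with `u_n ≤ n / N`. -/
noncomputable def nStar (N : ℕ) : ℕ := sInf {n : ℕ | secretaryValue N n ≤ (n : ℝ) / N}

/-- The relative rank of the object with index `i`: its rank among the objects that have appeared
up to and including it. -/
noncomputable def relRank {N : ℕ} (σ : Equiv.Perm (Fin N)) (i : Fin N) : ℕ :=
  {j : Fin N | j ≤ i ∧ σ j ≤ σ i}.ncard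

/-- Player 1 obtains the object with index `i`: it is the first object of relative rank 1 that
appears at moment `n*` or later. -/
def PlayerOneAccepts {N : ℕ} (σ : Equiv.Perm (Fin N)) (i : Fin N) : Prop :=
  (nStar N ≤ i.val + 1 ∧ relRank σ i = 1) ∧
    ∀ j < i, ¬ (nStar N ≤ j.val + 1 ∧ relRank σ j = 1)

/-- The object with index `i` is a candidate according to Player 2: Player 2 sees it (Player 1 has
not taken it), and it is better than all the earlier objects that Player 2 has seen. -/
def IsCandidate {N : ℕ} (σ : Equiv.Perm (Fin N)) (i : Fin N) : Prop :=
  ¬ PlayerOneAccepts σ i ∧ ∀ j < i, ¬ PlayerOneAccepts σ j → σ i < σ j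

open Classical in
/-- The history of Player 2 up to index `i`: the set of his decision points so far, that is, of the
moments at which the candidates according to him have appeared. -/
noncomputable def history {N : ℕ} (σ : Equiv.Perm (Fin N)) (i : Fin N) : Finset (Fin N) :=
  {j : Fin N | j ≤ i ∧ IsCandidate σ j}

/-- The histories at which Player 2 accepts the current candidate. (At a decision point the current
moment is the largest element of the history.) -/
abbrev Strategy (N : ℕ) : Type := Set (Finset (Fin N))

/-- Player 2, who has not accepted any of the first `n` objects and uses the strategy `τ` from then
on, obtains the best of all the objects. -/
def Wins {N : ℕ} (τ : Strategy N) (n : ℕ) (σ : Equiv.Perm (Fin N)) : Prop :=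
  ∃ i : Fin N, n ≤ i.val ∧ IsCandidate σ i ∧ history σ i ∈ τ ∧
    (∀ j < i, n ≤ j.val → IsCandidate σ j → history σ j ∉ τ) ∧ (σ i).val = 0

/-- The conditional probability of `A` given `E` when all orders of the objects are equally
likely. -/
noncomputable def condProb {N : ℕ} (A E : Set (Equiv.Perm (Fin N))) : ℝ :=
  ((A ∩ E).ncard : ℝ) / (E.ncard : ℝ)

/-- The event that the object with index `i` is a candidate according to Player 2 and that his
history is then `h`. -/
def historyEvent {N : ℕ} (i : Fin N) (h : Finset (Fin N)) : Set (Equiv.Perm (Fin N)) :=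
  {σ | IsCandidate σ i ∧ history σ i = h}

/-- The part of `historyEvent i h` on which the current candidate has relative rank `r`. -/
def historyRankEvent {N : ℕ} (i : Fin N) (h : Finset (Fin N)) (r : ℕ) :
    Set (Equiv.Perm (Fin N)) :=
  {σ | σ ∈ historyEvent i h ∧ relRank σ i = r}

/-- The posterior probability, given the history `h`, that the current candidate (index `i`) has
relative rank 1. -/
noncomputable def posterior {N : ℕ} (i : Fin N) (h : Finset (Fin N)) : ℝ :=
  condProb {σ | relRank σ i = 1} (historyEvent i h)

/-- The optimal expected payoff of Player 2 after he has rejected the current candidate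
(index `i`), given the history `h`. -/
noncomputable def historyValue {N : ℕ} (i : Fin N) (h : Finset (Fin N)) : ℝ :=
  ⨆ τ : Strategy N, condProb {σ | Wins τ (i.val + 1) σ} (historyEvent i h)

/-- The same when the current candidate, given the history `h`, has relative rank 1 with an
arbitrary probability `p` and relative rank 2 with probability `1 - p`. -/
noncomputable def beliefValue {N : ℕ} (i : Fin N) (h : Finset (Fin N)) (p : ℝ) : ℝ :=
  ⨆ τ : Strategy N,
    (p * condProb {σ | Wins τ (i.val + 1) σ} (historyRankEvent i h 1) +
      (1 - p) * condProb {σ | Wins τ (i.val + 1) σ} (historyRankEvent i h 2))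

/-- `v(n, 0)`, `n ≥ n*`: the optimal future expected payoff of Player 2 given that Player 1 has
accepted one of the first `n` objects and that Player 2 has not observed a candidate from moment
`n*` to moment `n`. -/
noncomputable def valueZero (N n : ℕ) : ℝ :=
  ⨆ τ : Strategy N, condProb {σ | Wins τ n σ}
    {σ | (∃ i : Fin N, i.val < n ∧ PlayerOneAccepts σ i) ∧
      ∀ j : Fin N, nStar N ≤ j.val + 1 → j.val < n → ¬ IsCandidate σ j}

/-- `v(n, -1)`: the optimal future expected payoff of Player 2 given that neither player has
accepted any of the first `n` objects. -/
noncomputable def valueNegOne (N n : ℕ) : ℝ :=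
  ⨆ τ : Strategy N, condProb {σ | Wins τ n σ}
    {σ | ∀ i : Fin N, i.val < n → ¬ PlayerOneAccepts σ i}

/-
The relative ranks of the objects are independent (they form the Lehmer code of the order). Hence,
whether Player 1 has accepted nothing, or his object has been beaten, or it is still leading, in
each of these three states the winning probability of a strategy of Player 2 is a number that
depends on the past only through his decision points. After Player 1's acceptance, the payoff of a
strategy is linear in the masses `w = (w₁, w₂)` of the states beaten and leading, so the optimal
value `V n w` is positively homogeneous and subadditive.

By backward induction `V n` does not decrease when mass moves from leading to beaten: relative to
the current belief, the gain if no candidate appears next compensates the loss, bounded by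
subadditivity, if one does. With `w = (p, 1 - p)` this is the monotonicity in `p`. It also makes
`V n (0, 1) = v(n, 0)` non-increasing in `n`; since before Player 1's acceptance the value of
Player 2 is at most a convex combination of the later values `V k (0, 1)`, `k > n`, and of `0` with
positive weight, it is smaller than `V n (0, 1)`.
-/

/-- The first `n` objects are in the same relative order. -/
def SameOrder {N : ℕ} (n : ℕ) (σ σ' : Equiv.Perm (Fin N)) : Prop :=
  ∀ j k : Fin N, j.val < n → k.val < n → (σ j < σ k ↔ σ' j < σ' k)

/-- The number of objects before `i` that are better than `i`: the relative rank counted from `0`,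
which makes the numbers `numBetter σ i` the Lehmer code of `σ`. -/
def numBetter {N : ℕ} (σ : Equiv.Perm (Fin N)) (i : Fin N) : ℕ :=
  ({j : Fin N | j < i ∧ σ j < σ i} : Finset (Fin N)).card

section NumBetter

variable {N : ℕ} {σ : Equiv.Perm (Fin N)} {i : Fin N}

theorem relRank_eq_numBetter_add_one (σ : Equiv.Perm (Fin N)) (i : Fin N) :
    relRank σ i = numBetter σ i + 1 := by
  have h : {j : Fin N | j ≤ i ∧ σ j ≤ σ i} = insert i {j : Fin N | j < i ∧ σ j < σ i} := by
    ext j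
    rcases eq_or_ne j i with rfl | hj
    · simp
    · simp [hj, hj.le_iff_lt, (σ.injective.ne hj).le_iff_lt]
  rw [relRank, h, Set.ncard_insert_of_notMem (by simp), numBetter, ← Set.ncard_coe_finset,
    Finset.coe_filter_univ]

theorem numBetter_le (σ : Equiv.Perm (Fin N)) (i : Fin N) : numBetter σ i ≤ i.val := by
  calc numBetter σ i ≤ (Finset.Iio i).card := Finset.card_le_card fun j hj =>
        Finset.mem_Iio.2 (Finset.mem_filter.1 hj).2.1
    _ = i.val := Fin.card_Iio i

theorem numBetter_eq_zero_iff : numBetter σ i = 0 ↔ ∀ j < i, σ i < σ j := by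
  rw [numBetter, Finset.card_eq_zero, Finset.filter_eq_empty_iff]
  refine ⟨fun h j hj => ?_, fun h j _ hj => hj.2.asymm (h j hj.1)⟩
  exact (not_lt.1 fun hlt => h (Finset.mem_univ j) ⟨hj, hlt⟩).lt_of_ne (σ.injective.ne hj.ne')

theorem numBetter_ne_zero_iff : numBetter σ i ≠ 0 ↔ ∃ j < i, σ j < σ i := by
  simp [numBetter, Finset.filter_eq_empty_iff]

theorem one_lt_numBetter_iff :
    1 < numBetter σ i ↔ ∃ j < i, ∃ k < i, σ j < σ i ∧ σ k < σ i ∧ j ≠ k := by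
  simp only [numBetter, Finset.one_lt_card, Finset.mem_filter, Finset.mem_univ, true_and]
  grind

theorem lt_iff_card_lt_numBetter {j : Fin N} (hj : j < i) :
    σ j < σ i ↔ ({k : Fin N | k < i ∧ σ k < σ j} : Finset (Fin N)).card < numBetter σ i := by
  constructor
  · refine fun hlt => Finset.card_lt_card <| Finset.ssubset_iff_of_subset ?_ |>.2 ⟨j, ?_⟩
    · exact Finset.monotone_filter_right _ fun k _ hk => ⟨hk.1, hk.2.trans hlt⟩
    · simp [hj, hlt]
  · refine fun hcard => not_le.1 fun hle => hcard.not_ge (Finset.card_le_card ?_)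
    exact Finset.monotone_filter_right _ fun k _ hk => ⟨hk.1, hk.2.trans_le hle⟩

end NumBetter

namespace SameOrder

variable {N n m : ℕ} {σ σ' : Equiv.Perm (Fin N)} {i : Fin N}

theorem mono (h : SameOrder n σ σ') (hm : m ≤ n) : SameOrder m σ σ' :=
  fun j k hj hk => h j k (hj.trans_le hm) (hk.trans_le hm)

theorem numBetter_eq (h : SameOrder n σ σ') (hi : i.val < n) :
    numBetter σ i = numBetter σ' i :=
  congrArg Finset.card <| Finset.filter_congr fun j _ =>
    and_congr_right fun hj => h j i (lt_trans hj hi) hi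

theorem relRank_eq (h : SameOrder n σ σ') (hi : i.val < n) : relRank σ i = relRank σ' i := by
  rw [relRank_eq_numBetter_add_one, relRank_eq_numBetter_add_one, h.numBetter_eq hi]

theorem playerOneAccepts_iff (h : SameOrder n σ σ') (hi : i.val < n) :
    PlayerOneAccepts σ i ↔ PlayerOneAccepts σ' i := by
  unfold PlayerOneAccepts
  rw [h.relRank_eq hi]
  refine and_congr_right fun _ => forall₂_congr fun j hj => ?_
  rw [h.relRank_eq (i := j) (lt_trans hj hi)]

theorem isCandidate_iff (h : SameOrder n σ σ') (hi : i.val < n) :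
    IsCandidate σ i ↔ IsCandidate σ' i := by
  unfold IsCandidate
  rw [h.playerOneAccepts_iff hi]
  refine and_congr_right fun _ => forall₂_congr fun j hj => ?_
  have hjn : j.val < n := lt_trans hj hi
  rw [h.playerOneAccepts_iff hjn, h i j hi hjn]

theorem succ (h : SameOrder i.val σ σ') (hi : numBetter σ i = numBetter σ' i) :
    SameOrder (i.val + 1) σ σ' := by
  have lt_last {j : Fin N} (hj : j < i) : σ j < σ i ↔ σ' j < σ' i := by
    rw [lt_iff_card_lt_numBetter hj, lt_iff_card_lt_numBetter hj, hi]
    refine iff_of_eq <| congrArg (fun s => Finset.card s < _) <| Finset.filter_congr fun k _ =>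
      and_congr_right fun hk => h k j hk hj
  have last_lt {j : Fin N} (hj : j < i) : σ i < σ j ↔ σ' i < σ' j := by
    rw [← not_iff_not, not_lt, not_lt, (σ.injective.ne hj.ne).le_iff_lt,
      (σ'.injective.ne hj.ne).le_iff_lt, lt_last hj]
  intro j k hj hk
  rcases Fin.eq_or_lt_of_le (Nat.lt_succ_iff.1 hj) with rfl | hj <;>
    rcases Fin.eq_or_lt_of_le (Nat.lt_succ_iff.1 hk) with rfl | hk
  · simp only [lt_irrefl]
  · exact last_lt hk
  · exact lt_last hj
  · exact h j k hj hk

theorem of_numBetter_eq (hn : n ≤ N)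
    (h : ∀ i : Fin N, i.val < n → numBetter σ i = numBetter σ' i) : SameOrder n σ σ' := by
  induction n with
  | zero => exact fun j k hj => absurd hj (Nat.not_lt_zero _)
  | succ n ih =>
    exact (ih (Nat.le_of_succ_le hn) fun i hi => h i (Nat.lt_succ_of_lt hi)).succ (i := ⟨n, hn⟩)
      (h ⟨n, hn⟩ (Nat.lt_succ_self n))

theorem eq (h : SameOrder N σ σ') : σ = σ' := by
  have hmono : StrictMono (σ.symm.trans σ') := fun j k hjk =>
    (h (σ.symm j) (σ.symm k) (Fin.is_lt _) (Fin.is_lt _)).1 (by simpa using hjk)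
  ext i
  simpa using congrArg Fin.val (hmono.apply_eq (x := σ i)).symm

end SameOrder

section LehmerCode

variable {N : ℕ}

theorem bijective_lehmerCode : Function.Bijective fun (σ : Equiv.Perm (Fin N)) (i : Fin N) =>
    (⟨numBetter σ i, Nat.lt_succ_of_le (numBetter_le σ i)⟩ : Fin (i.val + 1)) := by
  refine (Fintype.bijective_iff_injective_and_card _).2 ⟨fun σ σ' h => ?_, ?_⟩
  · exact (SameOrder.of_numBetter_eq le_rfl fun i _ => congrArg Fin.val (congrFun h i)).eq
  · simp [Fintype.card_perm, Fin.prod_univ_eq_prod_range fun i => i + 1,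
      Finset.prod_range_add_one_eq_factorial]

/-- The Lehmer code as a bijection: the relative ranks of the objects can be prescribed
independently of each other, and they determine the order. -/
noncomputable def lehmerEquiv (N : ℕ) :
    Equiv.Perm (Fin N) ≃ ∀ i : Fin N, Fin (i.val + 1) :=
  Equiv.ofBijective _ bijective_lehmerCode

theorem val_lehmerEquiv (σ : Equiv.Perm (Fin N)) (i : Fin N) :
    (lehmerEquiv N σ i).val = numBetter σ i := rfl

/-- The order obtained from `σ` by changing the relative rank of the object `i` to `r + 1` and
keeping the relative ranks of all the other objects. -/
noncomputable def setNumBetter (i : Fin N) (r : Fin (i.val + 1)) (σ : Equiv.Perm (Fin N)) :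
    Equiv.Perm (Fin N) :=
  (lehmerEquiv N).symm (Function.update (lehmerEquiv N σ) i r)

variable {i : Fin N} (r s : Fin (i.val + 1)) (σ : Equiv.Perm (Fin N))

theorem numBetter_setNumBetter : numBetter (setNumBetter i r σ) i = r.val := by
  simp [← val_lehmerEquiv, setNumBetter]

theorem sameOrder_setNumBetter : SameOrder i.val σ (setNumBetter i r σ) := by
  refine .of_numBetter_eq i.is_lt.le fun j hj => ?_
  simp [← val_lehmerEquiv, setNumBetter, Function.update_of_ne (Fin.ne_of_lt hj)]

theorem setNumBetter_setNumBetter : setNumBetter i r (setNumBetter i s σ) = setNumBetter i r σ := by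
  simp [setNumBetter]

variable {r σ}

theorem setNumBetter_eq_self (h : numBetter σ i = r.val) : setNumBetter i r σ = σ := by
  have : lehmerEquiv N σ i = r := Fin.ext h
  simp [setNumBetter, ← this]

end LehmerCode

/-- The event `E` only depends on the relative order of the first `n` objects. -/
def Determined {N : ℕ} (n : ℕ) (E : Set (Equiv.Perm (Fin N))) : Prop :=
  ∀ σ σ', SameOrder n σ σ' → σ ∈ E → σ' ∈ E

/-- Given any event inside `S` that only depends on the relative order of the first `n` objects,
the event `W` has conditional probability `x`. The set `S` is usually itself such an event, but
quantifying over its subevents lets the histories of Player 2 refine `S`. -/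
def HasCondProb {N : ℕ} (n : ℕ) (S W : Set (Equiv.Perm (Fin N))) (x : ℝ) : Prop :=
  ∀ E ⊆ S, Determined n E → ((W ∩ E).ncard : ℝ) = x * E.ncard

theorem ncard_eq_sum_ncard_fiber {α β : Type*} {A : Set α}
    (hA : A.Finite) {f : α → β} {t : Finset β} (hf : Set.MapsTo f A t) :
    A.ncard = ∑ b ∈ t, (A ∩ {a | f a = b}).ncard := by
  classical
  rw [Set.ncard_eq_toFinset_card A hA, Finset.card_eq_sum_card_fiberwise (f := f) (t := t)
    (by simpa using hf)]
  refine Finset.sum_congr rfl fun b _ => ?_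
  rw [← Set.ncard_coe_finset]
  congr 1
  ext a
  simp

section Determined

variable {N n m : ℕ} {E E' : Set (Equiv.Perm (Fin N))}

theorem Determined.mono (h : Determined n E) (hm : n ≤ m) : Determined m E :=
  fun σ σ' hs => h σ σ' (hs.mono hm)

theorem Determined.inter (h : Determined n E) (h' : Determined n E') : Determined n (E ∩ E') :=
  fun σ σ' hs hE => ⟨h σ σ' hs hE.1, h' σ σ' hs hE.2⟩

theorem determined_numBetter (i : Fin N) (P : ℕ → Prop) :
    Determined (i.val + 1) {σ : Equiv.Perm (Fin N) | P (numBetter σ i)} :=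
  fun _ _ hs hσ => (congrArg P (hs.numBetter_eq (Nat.lt_succ_self _))).mp hσ

variable {i : Fin N}

theorem Determined.ncard_inter_numBetter_le (hE : Determined i.val E) (r s : Fin (i.val + 1)) :
    (E ∩ {σ | numBetter σ i = r}).ncard ≤ (E ∩ {σ | numBetter σ i = s}).ncard := by
  refine Set.ncard_le_ncard_of_injOn (setNumBetter i s)
    (fun σ hσ => ⟨hE σ _ (sameOrder_setNumBetter s σ) hσ.1, numBetter_setNumBetter s σ⟩) ?_
  refine Set.LeftInvOn.injOn (f₁' := setNumBetter i r) fun σ hσ => ?_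
  rw [setNumBetter_setNumBetter, setNumBetter_eq_self hσ.2]

theorem Determined.ncard_inter_numBetter (hE : Determined i.val E) {r : ℕ} (hr : r ≤ i.val) :
    ((E ∩ {σ | numBetter σ i = r}).ncard : ℝ) = E.ncard / (i.val + 1) := by
  have heq : ∀ s ∈ Finset.range (i.val + 1),
      (E ∩ {σ | numBetter σ i = s}).ncard = (E ∩ {σ | numBetter σ i = r}).ncard := by
    intro s hs
    let r' : Fin (i.val + 1) := ⟨r, Nat.lt_succ_of_le hr⟩
    let s' : Fin (i.val + 1) := ⟨s, Finset.mem_range.1 hs⟩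
    exact (hE.ncard_inter_numBetter_le s' r').antisymm (hE.ncard_inter_numBetter_le r' s')
  have hsum := ncard_eq_sum_ncard_fiber E.toFinite (f := fun σ => numBetter σ i)
    (t := Finset.range (i.val + 1)) fun σ _ => by
      simpa [Nat.lt_succ_iff] using numBetter_le σ i
  rw [Finset.sum_congr rfl heq, Finset.sum_const, Finset.card_range, smul_eq_mul] at hsum
  rw [hsum]
  push_cast
  field_simp

end Determined

namespace HasCondProb

variable {N n : ℕ} {S T W W' : Set (Equiv.Perm (Fin N))} {x y z : ℝ} {i : Fin N}

theorem mono (h : HasCondProb n T W x) (hST : S ⊆ T) : HasCondProb n S W x :=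
  fun E hE => h E (hE.trans hST)

theorem congr (h : HasCondProb n S W x) (hW : ∀ σ ∈ S, σ ∈ W' ↔ σ ∈ W) :
    HasCondProb n S W' x := fun E hE hdet => by
  rw [← h E hE hdet, show W' ∩ E = W ∩ E from Set.ext fun σ =>
    and_congr_left fun hσ => hW σ (hE hσ)]

theorem zero (hW : ∀ σ ∈ S, σ ∉ W) : HasCondProb n S W 0 := fun E hE _ => by
  rw [show W ∩ E = ∅ from Set.eq_empty_of_forall_notMem fun σ hσ => hW σ (hE hσ.2) hσ.1]
  simp

theorem one (hW : S ⊆ W) : HasCondProb n S W 1 := fun E hE _ => by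
  rw [Set.inter_eq_right.2 (hE.trans hW), one_mul]

theorem average {x : ℕ → ℝ}
    (h : ∀ r ≤ i.val, HasCondProb (i.val + 1) (S ∩ {σ | numBetter σ i = r}) W (x r)) :
    HasCondProb i.val S W ((∑ r ∈ Finset.range (i.val + 1), x r) / (i.val + 1)) := by
  intro E hE hdet
  have hfiber := ncard_eq_sum_ncard_fiber (W ∩ E).toFinite (f := fun σ => numBetter σ i)
    (t := Finset.range (i.val + 1)) fun σ _ => by
      simpa [Nat.lt_succ_iff] using numBetter_le σ i
  rw [hfiber, Nat.cast_sum, Finset.sum_div, Finset.sum_mul]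
  refine Finset.sum_congr rfl fun r hr => ?_
  have hri : r ≤ i.val := Nat.lt_succ_iff.1 (Finset.mem_range.1 hr)
  rw [Set.inter_assoc, h r hri _ (Set.inter_subset_inter_left _ hE)
    ((hdet.mono (Nat.le_succ _)).inter (determined_numBetter i (· = r))),
    hdet.ncard_inter_numBetter hri]
  ring

theorem average_zero_ne_zero
    (h₀ : HasCondProb (i.val + 1) (S ∩ {σ | numBetter σ i = 0}) W x)
    (h₁ : HasCondProb (i.val + 1) (S ∩ {σ | numBetter σ i ≠ 0}) W y) :
    HasCondProb i.val S W (1 / (i.val + 1) * x + i.val / (i.val + 1) * y) := by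
  convert average (x := fun r => if r = 0 then x else y) fun r _ => ?_ using 1
  · simp only [Finset.sum_range_succ', Nat.add_eq_zero_iff, one_ne_zero, and_false, if_true,
      if_false, Finset.sum_const, Finset.card_range, nsmul_eq_mul]
    ring
  · rcases eq_or_ne r 0 with rfl | hr
    · simpa using h₀
    · rw [if_neg hr]
      exact h₁.mono (Set.inter_subset_inter_right _ fun σ hσ => ne_of_eq_of_ne hσ hr)

theorem average_zero_one_gt_one (hi : 0 < i.val)
    (h₀ : HasCondProb (i.val + 1) (S ∩ {σ | numBetter σ i = 0}) W x)
    (h₁ : HasCondProb (i.val + 1) (S ∩ {σ | numBetter σ i = 1}) W y)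
    (h₂ : HasCondProb (i.val + 1) (S ∩ {σ | 1 < numBetter σ i}) W z) :
    HasCondProb i.val S W
      (1 / (i.val + 1) * x + 1 / (i.val + 1) * y + (i.val - 1) / (i.val + 1) * z) := by
  convert average (x := fun r => if r = 0 then x else if r = 1 then y else z) fun r _ => ?_ using 1
  · obtain ⟨k, hk⟩ := Nat.exists_eq_succ_of_ne_zero hi.ne'
    simp only [hk, Nat.succ_eq_add_one, Nat.cast_add, Nat.cast_one, add_sub_cancel_right,
      Finset.sum_range_succ', Nat.add_eq_zero_iff, one_ne_zero, and_false, if_true, if_false,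
      Nat.add_eq_right, Finset.sum_const, Finset.card_range, nsmul_eq_mul]
    ring
  · rcases eq_or_ne r 0 with rfl | hr₀
    · simpa using h₀
    rcases eq_or_ne r 1 with rfl | hr₁
    · simpa using h₁
    · rw [if_neg hr₀, if_neg hr₁]
      have hr : 1 < r := by omega
      exact h₂.mono (Set.inter_subset_inter_right _ fun σ hσ => hr.trans_eq hσ.symm)

theorem condProb_eq (h : HasCondProb n S W x) {E : Set (Equiv.Perm (Fin N))} (hE : E ⊆ S)
    (hdet : Determined n E) (hne : E.Nonempty) : condProb W E = x := by
  rw [condProb, h E hE hdet, mul_div_cancel_right₀]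
  exact Nat.cast_ne_zero.2 ((Set.ncard_pos E.toFinite).2 hne).ne'

end HasCondProb

theorem hasCondProb_best {N m : ℕ} {i : Fin N} (hi : i.val < m) (hm : m ≤ N) :
    HasCondProb m {σ : Equiv.Perm (Fin N) | ∀ j : Fin N, j.val < m → σ i ≤ σ j}
      {σ | (σ i).val = 0} (m / N) := by
  have hN : (N : ℝ) ≠ 0 := Nat.cast_ne_zero.2 (Nat.ne_of_gt i.pos)
  induction hm using Nat.decreasingInduction with
  | self =>
    rw [div_self hN]
    refine .one fun σ hσ => ?_
    have := hσ (σ.symm ⟨0, i.pos⟩) (Fin.is_lt _)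
    rw [Equiv.apply_symm_apply] at this
    exact Nat.le_zero.1 this
  | of_succ m hm ih =>
    convert HasCondProb.average_zero_ne_zero (i := ⟨m, hm⟩) (x := 0) (.zero ?_)
      ((ih (Nat.lt_succ_of_lt hi)).mono ?_) using 1
    · push_cast
      field_simp
      ring
    · intro σ hσ h0
      have : (σ ⟨m, hm⟩).val < (σ i).val := numBetter_eq_zero_iff.1 hσ.2 i hi
      exact absurd this (h0 ▸ Nat.not_lt_zero _)
    · intro σ hσ j hj
      rcases Nat.lt_succ_iff_lt_or_eq.1 hj with hj | hj
      · exact hσ.1 j hj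
      · obtain ⟨k, hk, hlt⟩ := numBetter_ne_zero_iff.1 hσ.2
        rw [show j = ⟨m, hm⟩ from Fin.ext hj]
        exact (hσ.1 k hk).trans hlt.le

section CondProb

variable {N : ℕ} (W E P : Set (Equiv.Perm (Fin N)))

theorem condProb_mul_condProb : condProb P E * condProb W (E ∩ P) = condProb (W ∩ P) E := by
  rw [condProb, condProb, condProb, Set.inter_comm P E, Set.inter_right_comm, Set.inter_assoc]
  rcases (E ∩ P).eq_empty_or_nonempty with h | h
  · simp [h]
  · have := Nat.cast_ne_zero (R := ℝ).2 ((Set.ncard_pos (E ∩ P).toFinite).2 h).ne'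
    field_simp

theorem condProb_eq_add : condProb W E =
    condProb P E * condProb W (E ∩ P) + (1 - condProb P E) * condProb W (E \ P) := by
  have hsplit (A : Set (Equiv.Perm (Fin N))) :
      condProb A E = condProb (A ∩ P) E + condProb (A ∩ Pᶜ) E := by
    rw [condProb, condProb, condProb, ← add_div, ← Nat.cast_add, ← Set.sdiff_eq,
      Set.inter_right_comm, Set.inter_comm (A \ P), ← Set.inter_sdiff_assoc, Set.inter_comm E A,
      Set.ncard_inter_add_ncard_sdiff_eq_ncard _ _ (Set.toFinite _)]
  rcases E.eq_empty_or_nonempty with rfl | hE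
  · simp [condProb]
  have hcompl : 1 - condProb P E = condProb Pᶜ E := by
    have huniv : condProb Set.univ E = 1 := by
      rw [condProb, Set.univ_inter, div_self]
      exact Nat.cast_ne_zero.2 ((Set.ncard_pos E.toFinite).2 hE).ne'
    rw [← huniv, hsplit, Set.univ_inter, Set.univ_inter, add_sub_cancel_left]
  rw [hcompl, Set.sdiff_eq, condProb_mul_condProb, condProb_mul_condProb, ← hsplit]

end CondProb

section Candidates

variable {N n : ℕ} {σ σ' : Equiv.Perm (Fin N)} {i a j : Fin N}

open Classical in
/-- The moments before `n` at which candidates according to Player 2 have appeared. -/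
noncomputable def candidatesBefore (σ : Equiv.Perm (Fin N)) (n : ℕ) : Finset (Fin N) :=
  {j : Fin N | j.val < n ∧ IsCandidate σ j}

theorem mem_candidatesBefore : j ∈ candidatesBefore σ n ↔ j.val < n ∧ IsCandidate σ j := by
  simp only [candidatesBefore, Finset.mem_filter, Finset.mem_univ, true_and]

theorem history_eq_candidatesBefore (σ : Equiv.Perm (Fin N)) (i : Fin N) :
    history σ i = candidatesBefore σ (i.val + 1) := by
  ext j
  simp only [history, mem_candidatesBefore, Finset.mem_filter, Finset.mem_univ, true_and,
    Nat.lt_succ_iff, Fin.le_def]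

theorem IsCandidate.candidatesBefore_succ (hc : IsCandidate σ i) :
    candidatesBefore σ (i.val + 1) = insert i (candidatesBefore σ i.val) := by
  ext j
  simp only [Finset.mem_insert, mem_candidatesBefore]
  grind

theorem candidatesBefore_succ_of_not_isCandidate (hc : ¬ IsCandidate σ i) :
    candidatesBefore σ (i.val + 1) = candidatesBefore σ i.val := by
  ext j
  simp only [mem_candidatesBefore]
  grind

theorem SameOrder.candidatesBefore_eq (hs : SameOrder n σ σ') :
    candidatesBefore σ n = candidatesBefore σ' n := by
  ext j
  rw [mem_candidatesBefore, mem_candidatesBefore]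
  exact and_congr_right fun hj => hs.isCandidate_iff hj

theorem PlayerOneAccepts.unique {b : Fin N} (ha : PlayerOneAccepts σ a)
    (hb : PlayerOneAccepts σ b) : a = b :=
  le_antisymm (not_lt.1 fun h => ha.2 b h hb.1) (not_lt.1 fun h => hb.2 a h ha.1)

theorem PlayerOneAccepts.lt_of_lt (ha : PlayerOneAccepts σ a) (hj : j < a) : σ a < σ j :=
  numBetter_eq_zero_iff.1
    (Nat.succ_injective ((relRank_eq_numBetter_add_one σ a).symm.trans ha.1.2)) j hj

theorem PlayerOneAccepts.le_of_le (ha : PlayerOneAccepts σ a) (hj : j ≤ a) : σ a ≤ σ j :=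
  hj.eq_or_lt.elim (fun h => h ▸ le_rfl) fun h => (ha.lt_of_lt h).le

theorem exists_playerOneAccepts_le (hn : nStar N ≤ i.val + 1) (h0 : numBetter σ i = 0) :
    ∃ a ≤ i, PlayerOneAccepts σ a := by
  let p : Fin N → Prop := fun j => nStar N ≤ j.val + 1 ∧ relRank σ j = 1
  have hi : p i := ⟨hn, by rw [relRank_eq_numBetter_add_one, h0]⟩
  obtain ⟨a, hai, ha⟩ := exists_minimal_le_of_wellFoundedLT p i hi
  exact ⟨a, hai, ha.1, fun j hj hpj => hj.not_ge (ha.2 hpj hj.le)⟩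

theorem PlayerOneAccepts.isCandidate_iff (ha : PlayerOneAccepts σ a) :
    IsCandidate σ i ↔ i ≠ a ∧ ∀ j < i, j ≠ a → σ i < σ j := by
  have h (j : Fin N) : PlayerOneAccepts σ j ↔ j = a := ⟨fun hj => hj.unique ha, (· ▸ ha)⟩
  simp only [IsCandidate, h, ne_eq]

theorem not_isCandidate_of_not_playerOneAccepts (hn : nStar N ≤ i.val + 1)
    (hno : ∀ j < i, ¬ PlayerOneAccepts σ j) : ¬ IsCandidate σ i := fun hc => by
  obtain ⟨a, hai, ha⟩ := exists_playerOneAccepts_le hn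
    (numBetter_eq_zero_iff.2 fun j hj => hc.2 j hj (hno j hj))
  rcases hai.eq_or_lt with rfl | hai
  · exact hc.1 ha
  · exact hno a hai ha

theorem isCandidate_iff_of_beaten (ha : PlayerOneAccepts σ a) (hai : a < i) (hji : j < i)
    (hja : σ j < σ a) : IsCandidate σ i ↔ numBetter σ i = 0 := by
  rw [ha.isCandidate_iff, numBetter_eq_zero_iff]
  refine ⟨fun hc k hk => ?_, fun h => ⟨hai.ne', fun k hk _ => h k hk⟩⟩
  rcases eq_or_ne k a with rfl | hka
  · exact (hc.2 j hji fun h => hja.ne (congrArg σ h)).trans hja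
  · exact hc.2 k hk hka

theorem isCandidate_iff_of_leading (ha : PlayerOneAccepts σ a) (hai : a < i)
    (hle : ∀ j < i, σ a ≤ σ j) : IsCandidate σ i ↔ numBetter σ i ≤ 1 := by
  rw [ha.isCandidate_iff, ← not_lt, one_lt_numBetter_iff]
  constructor
  · rintro ⟨-, hc⟩ ⟨j, hj, k, hk, hji, hki, hjk⟩
    rcases eq_or_ne j a with rfl | hja
    · exact (hc k hk hjk.symm).asymm hki
    · exact (hc j hj hja).asymm hji
  · refine fun h => ⟨hai.ne', fun j hj hja => not_le.1 fun hji => h ?_⟩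
    have hji : σ j < σ i := hji.lt_of_ne (σ.injective.ne hj.ne)
    exact ⟨j, hj, a, hai, hji, (hle j hj).trans_lt hji, hja⟩

end Candidates

/-- Player 1 has not accepted any of the first `n` objects, and Player 2's candidates so far have
appeared at the moments `h`. -/
def untakenState {N : ℕ} (n : ℕ) (h : Finset (Fin N)) : Set (Equiv.Perm (Fin N)) :=
  {σ | candidatesBefore σ n = h ∧ ∀ a : Fin N, a.val < n → ¬ PlayerOneAccepts σ a}

/-- Player 1 has accepted one of the first `n` objects, but not the best of them, and Player 2's
candidates so far have appeared at the moments `h`. -/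
def beatenState {N : ℕ} (n : ℕ) (h : Finset (Fin N)) : Set (Equiv.Perm (Fin N)) :=
  {σ | candidatesBefore σ n = h ∧
    ∃ a : Fin N, a.val < n ∧ PlayerOneAccepts σ a ∧ ∃ j : Fin N, j.val < n ∧ σ j < σ a}

/-- Player 1 has accepted the best of the first `n` objects, and Player 2's candidates so far have
appeared at the moments `h`. -/
def leadingState {N : ℕ} (n : ℕ) (h : Finset (Fin N)) : Set (Equiv.Perm (Fin N)) :=
  {σ | candidatesBefore σ n = h ∧
    ∃ a : Fin N, a.val < n ∧ PlayerOneAccepts σ a ∧ ∀ j : Fin N, j.val < n → σ a ≤ σ j}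

section States

variable {N n : ℕ} {σ : Equiv.Perm (Fin N)} {h : Finset (Fin N)} {i a : Fin N}

theorem mem_beatenState_or_mem_leadingState (han : a.val < n) (ha : PlayerOneAccepts σ a) :
    σ ∈ beatenState n (candidatesBefore σ n) ∨ σ ∈ leadingState n (candidatesBefore σ n) := by
  by_cases hj : ∃ j : Fin N, j.val < n ∧ σ j < σ a
  · exact Or.inl ⟨rfl, a, han, ha, hj⟩
  · push Not at hj
    exact Or.inr ⟨rfl, a, han, ha, hj⟩

theorem isCandidate_iff_of_mem_beatenState (hσ : σ ∈ beatenState i.val h) :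
    IsCandidate σ i ↔ numBetter σ i = 0 := by
  obtain ⟨-, a, hai, ha, j, hji, hja⟩ := hσ
  exact isCandidate_iff_of_beaten ha hai hji hja

theorem isCandidate_iff_of_mem_leadingState (hσ : σ ∈ leadingState i.val h) :
    IsCandidate σ i ↔ numBetter σ i ≤ 1 := by
  obtain ⟨-, a, hai, ha, hle⟩ := hσ
  exact isCandidate_iff_of_leading ha hai hle

theorem not_isCandidate_of_mem_untakenState (hn : nStar N ≤ i.val + 1)
    (hσ : σ ∈ untakenState i.val h) : ¬ IsCandidate σ i :=
  not_isCandidate_of_not_playerOneAccepts hn hσ.2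

theorem le_of_leading_of_numBetter_ne_zero (hle : ∀ j < i, σ a ≤ σ j)
    (h0 : numBetter σ i ≠ 0) (j : Fin N) (hj : j.val < i.val + 1) : σ a ≤ σ j := by
  rcases Fin.eq_or_lt_of_le (Nat.lt_succ_iff.1 hj) with rfl | hj
  · obtain ⟨k, hk, hlt⟩ := numBetter_ne_zero_iff.1 h0
    exact (hle k hk).trans hlt.le
  · exact hle j hj

theorem mem_beatenState_succ_of_best (hai : a < i) (ha : PlayerOneAccepts σ a)
    (h0 : numBetter σ i = 0) :
    σ ∈ beatenState (i.val + 1) (insert i (candidatesBefore σ i.val)) := by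
  have hbest := numBetter_eq_zero_iff.1 h0
  have hc : IsCandidate σ i := ha.isCandidate_iff.2 ⟨hai.ne', fun j hj _ => hbest j hj⟩
  exact ⟨hc.candidatesBefore_succ, a, Nat.lt_succ_of_lt hai, ha, i, Nat.lt_succ_self _, hbest a hai⟩

theorem mem_beatenState_succ (hσ : σ ∈ beatenState i.val h) (h0 : numBetter σ i ≠ 0) :
    σ ∈ beatenState (i.val + 1) h := by
  have hc := (isCandidate_iff_of_mem_beatenState hσ).not.2 h0
  obtain ⟨hh, a, hai, ha, j, hji, hja⟩ := hσ
  exact ⟨(candidatesBefore_succ_of_not_isCandidate hc).trans hh, a, Nat.lt_succ_of_lt hai, ha, j,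
    Nat.lt_succ_of_lt hji, hja⟩

theorem mem_leadingState_succ_insert (hσ : σ ∈ leadingState i.val h) (h1 : numBetter σ i = 1) :
    σ ∈ leadingState (i.val + 1) (insert i h) := by
  have hc := (isCandidate_iff_of_mem_leadingState hσ).2 h1.le
  obtain ⟨hh, a, hai, ha, hle⟩ := hσ
  exact ⟨hh ▸ hc.candidatesBefore_succ, a, Nat.lt_succ_of_lt hai, ha,
    le_of_leading_of_numBetter_ne_zero hle (h1 ▸ one_ne_zero)⟩

theorem mem_leadingState_succ (hσ : σ ∈ leadingState i.val h) (h1 : 1 < numBetter σ i) :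
    σ ∈ leadingState (i.val + 1) h := by
  have hc := (isCandidate_iff_of_mem_leadingState hσ).not.2 h1.not_ge
  obtain ⟨hh, a, hai, ha, hle⟩ := hσ
  exact ⟨(candidatesBefore_succ_of_not_isCandidate hc).trans hh, a, Nat.lt_succ_of_lt hai, ha,
    le_of_leading_of_numBetter_ne_zero hle (zero_lt_one.trans h1).ne'⟩

theorem mem_leadingState_succ_of_mem_untakenState (hn : nStar N ≤ i.val + 1)
    (hσ : σ ∈ untakenState i.val h) (h0 : numBetter σ i = 0) :
    σ ∈ leadingState (i.val + 1) h := by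
  have hc := not_isCandidate_of_mem_untakenState hn hσ
  obtain ⟨a, hai, ha⟩ := exists_playerOneAccepts_le hn h0
  obtain rfl : a = i := hai.eq_of_not_lt fun hlt => hσ.2 a hlt ha
  exact ⟨(candidatesBefore_succ_of_not_isCandidate hc).trans hσ.1, a, Nat.lt_succ_self _, ha,
    fun j hj => ha.le_of_le (Nat.lt_succ_iff.1 hj)⟩

theorem mem_untakenState_succ (hn : nStar N ≤ i.val + 1) (hσ : σ ∈ untakenState i.val h)
    (h0 : numBetter σ i ≠ 0) : σ ∈ untakenState (i.val + 1) h := by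
  have hc := not_isCandidate_of_mem_untakenState hn hσ
  refine ⟨(candidatesBefore_succ_of_not_isCandidate hc).trans hσ.1, fun a ha hp => ?_⟩
  rcases Fin.eq_or_lt_of_le (Nat.lt_succ_iff.1 ha) with rfl | ha
  · obtain ⟨j, hj, hlt⟩ := numBetter_ne_zero_iff.1 h0
    exact hlt.asymm (hp.lt_of_lt hj)
  · exact hσ.2 a ha hp

end States

section Wins

variable {N : ℕ} {τ : Strategy N} {σ : Equiv.Perm (Fin N)} {i : Fin N}

theorem not_wins_self (τ : Strategy N) (σ : Equiv.Perm (Fin N)) : ¬ Wins τ N σ :=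
  fun ⟨i, hi, _⟩ => hi.not_gt i.is_lt

theorem wins_iff_of_not_accepts (h : ¬ (IsCandidate σ i ∧ history σ i ∈ τ)) :
    Wins τ i.val σ ↔ Wins τ (i.val + 1) σ := by
  refine exists_congr fun k => ⟨?_, ?_⟩
  · rintro ⟨hk, hc, hτ, hfirst, hbest⟩
    have hki : i ≠ k := fun hik => h (hik ▸ ⟨hc, hτ⟩)
    exact ⟨Nat.lt_of_le_of_ne hk (Fin.val_ne_of_ne hki), hc, hτ,
      fun j hjk hj => hfirst j hjk (Nat.le_of_succ_le hj), hbest⟩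
  · rintro ⟨hk, hc, hτ, hfirst, hbest⟩
    refine ⟨Nat.le_of_succ_le hk, hc, hτ, fun j hjk hij hcj hjτ => ?_, hbest⟩
    rcases Fin.eq_or_lt_of_le hij with rfl | hij
    · exact h ⟨hcj, hjτ⟩
    · exact hfirst j hjk hij hcj hjτ

theorem wins_iff_of_accepts (hc : IsCandidate σ i) (hτ : history σ i ∈ τ) :
    Wins τ i.val σ ↔ (σ i).val = 0 := by
  constructor
  · rintro ⟨k, hk, -, -, hfirst, hbest⟩
    obtain rfl : i = k := eq_of_le_of_not_lt hk fun hik => hfirst i hik le_rfl hc hτ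
    exact hbest
  · exact fun hbest => ⟨i, le_rfl, hc, hτ, fun j hj hij => absurd hj (not_lt.2 hij), hbest⟩

end Wins

namespace HasCondProb

variable {N m : ℕ} {S : Set (Equiv.Perm (Fin N))} {τ : Strategy N} {i : Fin N} {x y z : ℝ}

theorem wins_of_not_isCandidate (hc : ∀ σ ∈ S, ¬ IsCandidate σ i)
    (h : HasCondProb m S {σ | Wins τ (i.val + 1) σ} x) :
    HasCondProb m S {σ | Wins τ i.val σ} x :=
  h.congr fun σ hσ => wins_iff_of_not_accepts fun hacc => hc σ hσ hacc.1

open Classical in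
theorem wins_of_isCandidate {h : Finset (Fin N)} (hc : ∀ σ ∈ S, IsCandidate σ i)
    (hh : ∀ σ ∈ S, candidatesBefore σ (i.val + 1) = h)
    (hx : HasCondProb m S {σ | (σ i).val = 0} x)
    (hy : HasCondProb m S {σ | Wins τ (i.val + 1) σ} y) :
    HasCondProb m S {σ | Wins τ i.val σ} (if h ∈ τ then x else y) := by
  simp only [← history_eq_candidatesBefore] at hh
  split_ifs with hτ
  · exact hx.congr fun σ hσ => wins_iff_of_accepts (hc σ hσ) ((hh σ hσ).symm ▸ hτ)
  · exact hy.congr fun σ hσ => wins_iff_of_not_accepts fun hacc => hτ (hh σ hσ ▸ hacc.2)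

open Classical in
theorem wins_of_best {h : Finset (Fin N)}
    (hS : ∀ σ ∈ S, candidatesBefore σ i.val = h ∧ ∃ a < i, PlayerOneAccepts σ a)
    (hy : HasCondProb (i.val + 1) (beatenState (i.val + 1) (insert i h))
      {σ | Wins τ (i.val + 1) σ} y) :
    HasCondProb (i.val + 1) (S ∩ {σ | numBetter σ i = 0}) {σ | Wins τ i.val σ}
      (if insert i h ∈ τ then ((i.val + 1 : ℕ) / N : ℝ) else y) := by
  have hbeaten : ∀ σ ∈ S ∩ {σ | numBetter σ i = 0},
      σ ∈ beatenState (i.val + 1) (insert i h) := by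
    rintro σ ⟨hσ, h0⟩
    obtain ⟨rfl, a, hai, ha⟩ := hS σ hσ
    exact mem_beatenState_succ_of_best hai ha h0
  refine .wins_of_isCandidate (fun σ hσ => ?_) (fun σ hσ => (hbeaten σ hσ).1)
    ((hasCondProb_best (Nat.lt_succ_self _) i.is_lt).mono fun σ hσ j hj => ?_) (hy.mono hbeaten)
  · obtain ⟨-, a, hai, ha⟩ := hS σ hσ.1
    exact ha.isCandidate_iff.2 ⟨hai.ne', fun j hj _ => numBetter_eq_zero_iff.1 hσ.2 j hj⟩
  · rcases Fin.eq_or_lt_of_le (Nat.lt_succ_iff.1 hj) with rfl | hj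
    · exact le_rfl
    · exact (numBetter_eq_zero_iff.1 hσ.2 j hj).le

open Classical in
theorem beatenState_step {h : Finset (Fin N)}
    (hx : HasCondProb (i.val + 1) (beatenState (i.val + 1) (insert i h))
      {σ | Wins τ (i.val + 1) σ} x)
    (hy : HasCondProb (i.val + 1) (beatenState (i.val + 1) h) {σ | Wins τ (i.val + 1) σ} y) :
    HasCondProb i.val (beatenState i.val h) {σ | Wins τ i.val σ}
      (1 / (i.val + 1) * (if insert i h ∈ τ then ((i.val + 1 : ℕ) / N : ℝ) else x) +
        i.val / (i.val + 1) * y) := by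
  refine .average_zero_ne_zero (wins_of_best (fun σ hσ => ?_) hx)
    (.wins_of_not_isCandidate (fun σ hσ => ?_) (hy.mono fun σ hσ => ?_))
  · exact ⟨hσ.1, hσ.2.imp fun a ha => ⟨ha.1, ha.2.1⟩⟩
  · exact (isCandidate_iff_of_mem_beatenState hσ.1).not.2 hσ.2
  · exact mem_beatenState_succ hσ.1 hσ.2

open Classical in
theorem leadingState_step {h : Finset (Fin N)} (hi : 0 < i.val)
    (hx : HasCondProb (i.val + 1) (beatenState (i.val + 1) (insert i h))
      {σ | Wins τ (i.val + 1) σ} x)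
    (hy : HasCondProb (i.val + 1) (leadingState (i.val + 1) (insert i h))
      {σ | Wins τ (i.val + 1) σ} y)
    (hz : HasCondProb (i.val + 1) (leadingState (i.val + 1) h) {σ | Wins τ (i.val + 1) σ} z) :
    HasCondProb i.val (leadingState i.val h) {σ | Wins τ i.val σ}
      (1 / (i.val + 1) * (if insert i h ∈ τ then ((i.val + 1 : ℕ) / N : ℝ) else x) +
        1 / (i.val + 1) * (if insert i h ∈ τ then 0 else y) + (i.val - 1) / (i.val + 1) * z) := by
  refine .average_zero_one_gt_one hi (wins_of_best (fun σ hσ => ?_) hx)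
    (.wins_of_isCandidate (fun σ hσ => ?_) (fun σ hσ => ?_) (.zero fun σ hσ hbest => ?_)
      (hy.mono fun σ hσ => ?_))
    (.wins_of_not_isCandidate (fun σ hσ => ?_) (hz.mono fun σ hσ => ?_))
  · exact ⟨hσ.1, hσ.2.imp fun a ha => ⟨ha.1, ha.2.1⟩⟩
  · exact (isCandidate_iff_of_mem_leadingState hσ.1).2 (le_of_eq hσ.2)
  · exact (mem_leadingState_succ_insert hσ.1 hσ.2).1
  · obtain ⟨j, -, hlt⟩ := numBetter_ne_zero_iff.1 (ne_of_eq_of_ne hσ.2 one_ne_zero)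
    exact (Fin.lt_def.1 hlt).not_ge (hbest.trans_le (Nat.zero_le _))
  · exact mem_leadingState_succ_insert hσ.1 hσ.2
  · exact (isCandidate_iff_of_mem_leadingState hσ.1).not.2 (not_le.2 hσ.2)
  · exact mem_leadingState_succ hσ.1 hσ.2

theorem untakenState_step {h : Finset (Fin N)} (hi : nStar N ≤ i.val + 1)
    (hx : HasCondProb (i.val + 1) (leadingState (i.val + 1) h) {σ | Wins τ (i.val + 1) σ} x)
    (hy : HasCondProb (i.val + 1) (untakenState (i.val + 1) h) {σ | Wins τ (i.val + 1) σ} y) :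
    HasCondProb i.val (untakenState i.val h) {σ | Wins τ i.val σ}
      (1 / (i.val + 1) * x + i.val / (i.val + 1) * y) := by
  refine .wins_of_not_isCandidate (fun σ => not_isCandidate_of_mem_untakenState hi)
    (.average_zero_ne_zero (hx.mono fun σ hσ => ?_) (hy.mono fun σ hσ => ?_))
  · exact mem_leadingState_succ_of_mem_untakenState hi hσ.1 hσ.2
  · exact mem_untakenState_succ hi hσ.1 hσ.2

end HasCondProb

/-- The masses of the two beliefs that the object of Player 1 is beaten and that it is leading,
on the event that the next object, after `n` objects, is not a candidate. Masses are not normalised: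
they need not add up to `1`. -/
noncomputable def noCandidateMass (n : ℕ) : ℝ × ℝ →ₗ[ℝ] ℝ × ℝ :=
  ((n / (n + 1) : ℝ) • LinearMap.id).prodMap (((n - 1) / (n + 1) : ℝ) • LinearMap.id)

/-- The masses of the two beliefs that the object of Player 1 is beaten and that it is leading,
on the event that the next object, after `n` objects, is a candidate. -/
noncomputable def candidateMass (n : ℕ) : ℝ × ℝ →ₗ[ℝ] ℝ × ℝ :=
  (1 / (n + 1) : ℝ) • (LinearMap.fst ℝ ℝ ℝ + LinearMap.snd ℝ ℝ ℝ).prod (LinearMap.snd ℝ ℝ ℝ)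

theorem noCandidateMass_apply (n : ℕ) (w : ℝ × ℝ) :
    noCandidateMass n w = (n / (n + 1) * w.1, (n - 1) / (n + 1) * w.2) := rfl

theorem candidateMass_apply (n : ℕ) (w : ℝ × ℝ) :
    candidateMass n w = (1 / (n + 1) * (w.1 + w.2), 1 / (n + 1) * w.2) := rfl

open Classical in
/-- The payoff of the strategy `τ` after `n` objects with the candidates `h`, as a function of the
masses of `beatenState n h` and `leadingState n h`. -/
noncomputable def payoff {N : ℕ} (τ : Strategy N) (n : ℕ) (h : Finset (Fin N)) : ℝ × ℝ →ₗ[ℝ] ℝ :=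
  if hn : n < N then
    payoff τ (n + 1) h ∘ₗ noCandidateMass n +
      if insert ⟨n, hn⟩ h ∈ τ then (1 / N : ℝ) • (LinearMap.fst ℝ ℝ ℝ + LinearMap.snd ℝ ℝ ℝ)
      else payoff τ (n + 1) (insert ⟨n, hn⟩ h) ∘ₗ candidateMass n
  else 0
termination_by N - n

/-- The payoff of the strategy `τ` on `untakenState n h`. -/
noncomputable def untakenPayoff {N : ℕ} (τ : Strategy N) (n : ℕ) (h : Finset (Fin N)) : ℝ :=
  if n < N then
    1 / (n + 1) * payoff τ (n + 1) h (0, 1) + n / (n + 1) * untakenPayoff τ (n + 1) h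
  else 0
termination_by N - n

section Payoff

variable {N n : ℕ}

theorem payoff_self (τ : Strategy N) (h : Finset (Fin N)) : payoff τ N h = 0 := by
  rw [payoff, dif_neg (lt_irrefl N)]

open Classical in
theorem payoff_of_lt (τ : Strategy N) (hn : n < N) (h : Finset (Fin N)) (w : ℝ × ℝ) :
    payoff τ n h w = payoff τ (n + 1) h (noCandidateMass n w) +
      if insert ⟨n, hn⟩ h ∈ τ then (w.1 + w.2) / N
      else payoff τ (n + 1) (insert ⟨n, hn⟩ h) (candidateMass n w) := by
  rw [payoff, dif_pos hn]
  split_ifs <;> simp [div_eq_inv_mul, mul_add]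

open Classical in
theorem payoff_one_zero (τ : Strategy N) (hn : n < N) (h : Finset (Fin N)) :
    payoff τ n h (1, 0) =
      1 / (n + 1) * (if insert ⟨n, hn⟩ h ∈ τ then ((n + 1 : ℕ) / N : ℝ)
        else payoff τ (n + 1) (insert ⟨n, hn⟩ h) (1, 0)) +
      n / (n + 1) * payoff τ (n + 1) h (1, 0) := by
  have h₀ : noCandidateMass n (1, 0) = (n / (n + 1) : ℝ) • (1, 0) := by
    simp [noCandidateMass_apply]
  have h₁ : candidateMass n (1, 0) = (1 / (n + 1) : ℝ) • (1, 0) := by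
    simp [candidateMass_apply]
  rw [payoff_of_lt τ hn, h₀, h₁, map_smul, map_smul, smul_eq_mul, smul_eq_mul]
  split_ifs <;> push_cast <;> field_simp <;> ring

open Classical in
theorem payoff_zero_one (τ : Strategy N) (hn : n < N) (h : Finset (Fin N)) :
    payoff τ n h (0, 1) =
      1 / (n + 1) * (if insert ⟨n, hn⟩ h ∈ τ then ((n + 1 : ℕ) / N : ℝ)
        else payoff τ (n + 1) (insert ⟨n, hn⟩ h) (1, 0)) +
      1 / (n + 1) * (if insert ⟨n, hn⟩ h ∈ τ then 0
        else payoff τ (n + 1) (insert ⟨n, hn⟩ h) (0, 1)) +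
      (n - 1) / (n + 1) * payoff τ (n + 1) h (0, 1) := by
  have h₀ : noCandidateMass n (0, 1) = ((n - 1) / (n + 1) : ℝ) • (0, 1) := by
    simp [noCandidateMass_apply]
  have h₁ : candidateMass n (0, 1) = (1 / (n + 1) : ℝ) • ((1, 0) + (0, 1)) := by
    simp [candidateMass_apply]
  rw [payoff_of_lt τ hn, h₀, h₁, map_smul, map_smul, map_add, smul_eq_mul, smul_eq_mul]
  split_ifs <;> push_cast <;> field_simp <;> ring

theorem hasCondProb_beatenState (τ : Strategy N) (hn : n ≤ N) (h : Finset (Fin N)) :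
    HasCondProb n (beatenState n h) {σ | Wins τ n σ} (payoff τ n h (1, 0)) := by
  induction hn using Nat.decreasingInduction generalizing h with
  | self =>
    rw [payoff_self]
    exact .zero fun σ _ => not_wins_self τ σ
  | of_succ n hn ih =>
    rw [payoff_one_zero τ hn]
    exact .beatenState_step (i := ⟨n, hn⟩) (ih _) (ih _)

theorem hasCondProb_leadingState (τ : Strategy N) (h0 : 0 < n) (hn : n ≤ N) (h : Finset (Fin N)) :
    HasCondProb n (leadingState n h) {σ | Wins τ n σ} (payoff τ n h (0, 1)) := by
  induction hn using Nat.decreasingInduction generalizing h with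
  | self =>
    rw [payoff_self]
    exact .zero fun σ _ => not_wins_self τ σ
  | of_succ n hn ih =>
    rw [payoff_zero_one τ hn]
    exact .leadingState_step (i := ⟨n, hn⟩) h0 (hasCondProb_beatenState τ hn _)
      (ih n.succ_pos _) (ih n.succ_pos _)

theorem hasCondProb_untakenState (τ : Strategy N) (hs : nStar N ≤ n + 1) (hn : n ≤ N)
    (h : Finset (Fin N)) :
    HasCondProb n (untakenState n h) {σ | Wins τ n σ} (untakenPayoff τ n h) := by
  induction hn using Nat.decreasingInduction with
  | self =>
    rw [untakenPayoff, if_neg (lt_irrefl N)]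
    exact .zero fun σ _ => not_wins_self τ σ
  | of_succ n hn ih =>
    rw [untakenPayoff, if_pos hn]
    exact .untakenState_step (i := ⟨n, hn⟩) hs
      (hasCondProb_leadingState τ n.succ_pos hn h) (ih (Nat.le_succ_of_le hs))

end Payoff

/-- The greatest payoff of a strategy of Player 2 after `n` objects, one of which Player 1 has
accepted, as a function of the masses of the two beliefs on whether Player 1's object is beaten or
leading. -/
noncomputable def optimalValue (N n : ℕ) (w : ℝ × ℝ) : ℝ :=
  if n < N then
    optimalValue N (n + 1) (noCandidateMass n w) +
      max ((w.1 + w.2) / N) (optimalValue N (n + 1) (candidateMass n w))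
  else 0
termination_by N - n

/-- A bound on the payoffs of the strategies of Player 2 when Player 1 has not accepted any of the
first `n` objects. -/
noncomputable def untakenValue (N n : ℕ) : ℝ :=
  if n < N then
    1 / (n + 1) * optimalValue N (n + 1) (0, 1) + n / (n + 1) * untakenValue N (n + 1)
  else 0
termination_by N - n

open Classical in
/-- The belief masses after `k` objects, starting from `w` after `n ≤ k` objects, when the
candidates between the moments `n` and `k` appear at the elements of `s`. -/
noncomputable def belief {N : ℕ} (n : ℕ) (w : ℝ × ℝ) (s : Finset (Fin N)) : ℕ → ℝ × ℝ
  | 0 => w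
  | k + 1 =>
    if k < n then w
    else if ∃ j ∈ s, j.val = k then candidateMass k (belief n w s k)
    else noCandidateMass k (belief n w s k)

/-- The strategy that accepts a candidate whenever stopping is at least as good as continuing
optimally, given the belief computed from `w` after `n` objects. -/
def greedyStrategy (N n : ℕ) (w : ℝ × ℝ) : Strategy N :=
  {s | ∃ i ∈ s, (∀ j ∈ s, j ≤ i) ∧
    optimalValue N (i.val + 1) (candidateMass i.val (belief n w s i.val)) ≤
      ((belief n w s i.val).1 + (belief n w s i.val).2) / N}

section Optimality

variable {N n k : ℕ} {w : ℝ × ℝ} {h : Finset (Fin N)}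

theorem optimalValue_self (N : ℕ) (w : ℝ × ℝ) : optimalValue N N w = 0 := by
  rw [optimalValue, if_neg (lt_irrefl N)]

theorem optimalValue_of_lt (hn : n < N) (w : ℝ × ℝ) : optimalValue N n w =
    optimalValue N (n + 1) (noCandidateMass n w) +
      max ((w.1 + w.2) / N) (optimalValue N (n + 1) (candidateMass n w)) := by
  rw [optimalValue, if_pos hn]

theorem payoff_le_optimalValue (τ : Strategy N) (hn : n ≤ N) (h : Finset (Fin N)) (w : ℝ × ℝ) :
    payoff τ n h w ≤ optimalValue N n w := by
  induction hn using Nat.decreasingInduction generalizing h w with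
  | self => rw [payoff_self, optimalValue_self, LinearMap.zero_apply]
  | of_succ n hn ih =>
    rw [payoff_of_lt τ hn, optimalValue_of_lt hn]
    refine add_le_add (ih _ _) ?_
    split_ifs
    · exact le_max_left _ _
    · exact (ih _ _).trans (le_max_right _ _)

theorem untakenPayoff_le_untakenValue (τ : Strategy N) (hn : n ≤ N) (h : Finset (Fin N)) :
    untakenPayoff τ n h ≤ untakenValue N n := by
  induction hn using Nat.decreasingInduction with
  | self => rw [untakenPayoff, untakenValue, if_neg (lt_irrefl N), if_neg (lt_irrefl N)]
  | of_succ n hn ih =>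
    rw [untakenPayoff, untakenValue, if_pos hn, if_pos hn]
    gcongr
    exact payoff_le_optimalValue τ hn h _

theorem belief_self (n : ℕ) (w : ℝ × ℝ) (s : Finset (Fin N)) : belief n w s n = w := by
  cases n with
  | zero => rfl
  | succ n => rw [belief, if_pos (Nat.lt_succ_self n)]

theorem belief_congr {s t : Finset (Fin N)} (hst : ∀ j : Fin N, j.val < k → (j ∈ s ↔ j ∈ t)) :
    belief n w s k = belief n w t k := by
  induction k with
  | zero => rfl
  | succ k ih =>
    have hk : (∃ j ∈ s, j.val = k) ↔ ∃ j ∈ t, j.val = k := exists_congr fun j =>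
      and_congr_left fun hj => hst j (hj.trans_lt (Nat.lt_succ_self k))
    rw [belief, belief, ih fun j hj => hst j (Nat.lt_succ_of_lt hj)]
    simp only [hk]

theorem belief_insert (hk : k < N) :
    belief n w (insert ⟨k, hk⟩ h) k = belief n w h k := by
  refine belief_congr fun j hj => ?_
  rw [Finset.mem_insert, or_iff_right (Fin.ne_of_lt hj)]

theorem belief_succ (hn : n ≤ k) (hh : ∀ j ∈ h, j.val < k) :
    belief n w h (k + 1) = noCandidateMass k (belief n w h k) := by
  rw [belief, if_neg hn.not_gt, if_neg fun ⟨j, hj, hjk⟩ => (hh j hj).ne hjk]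

theorem belief_insert_succ (hn : n ≤ k) (hk : k < N) :
    belief n w (insert ⟨k, hk⟩ h) (k + 1) = candidateMass k (belief n w h k) := by
  rw [belief, if_neg hn.not_gt, if_pos ⟨⟨k, hk⟩, Finset.mem_insert_self _ _, rfl⟩,
    belief_insert hk]

theorem insert_mem_greedyStrategy_iff (hk : k < N) (hh : ∀ j ∈ h, j.val < k) :
    insert ⟨k, hk⟩ h ∈ greedyStrategy N n w ↔
      optimalValue N (k + 1) (candidateMass k (belief n w h k)) ≤
        ((belief n w h k).1 + (belief n w h k).2) / N := by
  have hmax : ∀ j ∈ insert ⟨k, hk⟩ h, j ≤ ⟨k, hk⟩ := fun j hj =>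
    (Finset.mem_insert.1 hj).elim le_of_eq fun hj => (hh j hj).le
  constructor
  · rintro ⟨i, hi, hle, hval⟩
    obtain rfl : i = ⟨k, hk⟩ := (hmax i hi).antisymm (hle _ (Finset.mem_insert_self _ _))
    rwa [belief_insert hk] at hval
  · exact fun hval =>
      ⟨⟨k, hk⟩, Finset.mem_insert_self _ _, hmax, by rwa [belief_insert hk]⟩

theorem payoff_greedyStrategy_belief (hn : n ≤ k) (hk : k ≤ N) (hh : ∀ j ∈ h, j.val < k) :
    payoff (greedyStrategy N n w) k h (belief n w h k) = optimalValue N k (belief n w h k) := by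
  induction hk using Nat.decreasingInduction generalizing h with
  | self => rw [payoff_self, optimalValue_self, LinearMap.zero_apply]
  | of_succ k hk ih =>
    have hinsert : ∀ j ∈ insert ⟨k, hk⟩ h, j.val < k + 1 := fun j hj =>
      (Finset.mem_insert.1 hj).elim (fun hj => hj ▸ Nat.lt_succ_self k)
        fun hj => Nat.lt_succ_of_lt (hh j hj)
    have hno := ih (Nat.le_succ_of_le hn) fun j hj => Nat.lt_succ_of_lt (hh j hj)
    have hyes := ih (Nat.le_succ_of_le hn) hinsert
    rw [belief_succ hn hh] at hno
    rw [belief_insert_succ hn hk] at hyes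
    rw [payoff_of_lt _ hk, optimalValue_of_lt hk, hno, hyes]
    simp only [insert_mem_greedyStrategy_iff hk hh]
    rw [max_comm, max_def]

theorem payoff_greedyStrategy (hn : n ≤ N) (hh : ∀ j ∈ h, j.val < n) :
    payoff (greedyStrategy N n w) n h w = optimalValue N n w := by
  simpa only [belief_self] using payoff_greedyStrategy_belief (w := w) le_rfl hn hh

theorem iSup_payoff (hn : n ≤ N) (hh : ∀ j ∈ h, j.val < n) :
    ⨆ τ : Strategy N, payoff τ n h w = optimalValue N n w :=
  IsLUB.ciSup_eq <| IsGreatest.isLUB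
    ⟨⟨greedyStrategy N n w, payoff_greedyStrategy hn hh⟩,
      Set.forall_mem_range.2 fun τ => payoff_le_optimalValue τ hn h w⟩

end Optimality

/-- Moving mass from the second to the first coordinate does not decrease `f` on the quadrant. -/
def ShiftMonotone (f : ℝ × ℝ → ℝ) : Prop :=
  ∀ a b t : ℝ, 0 ≤ a → 0 ≤ t → t ≤ b → f (a, b) ≤ f (a + t, b - t)

section Monotonicity

theorem ShiftMonotone.monotoneOn {f : ℝ × ℝ → ℝ} (hf : ShiftMonotone f) :
    MonotoneOn (fun p => f (p, 1 - p)) (Set.Icc 0 1) := by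
  intro p hp q hq hpq
  have := hf p (1 - p) (q - p) hp.1 (sub_nonneg.2 hpq) (sub_le_sub_right hq.2 p)
  rwa [add_sub_cancel, sub_sub_sub_cancel_right] at this

theorem ShiftMonotone.mul_le {f : ℝ × ℝ → ℝ} (hf : ShiftMonotone f)
    (hsmul : ∀ (c : ℝ) (w : ℝ × ℝ), 0 ≤ c → f (c • w) = c * f w) {u v : ℝ} (hu : 0 ≤ u)
    (hv : 0 ≤ v) : (u + v) * f (0, 1) ≤ f (u, v) := by
  have := hf 0 (u + v) u le_rfl hu (le_add_of_nonneg_right hv)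
  rw [zero_add, add_sub_cancel_left] at this
  simpa [← hsmul (u + v) _ (add_nonneg hu hv)] using this

/-- Scaling `(u, v)` up to the total mass `u + v + s` and then shifting leads to `(u + s, v)`. -/
theorem ShiftMonotone.add_mul_le {f : ℝ × ℝ → ℝ} (hf : ShiftMonotone f)
    (hsmul : ∀ (c : ℝ) (w : ℝ × ℝ), 0 ≤ c → f (c • w) = c * f w) {u v s : ℝ} (hu : 0 ≤ u)
    (hv : 0 ≤ v) (hs : 0 ≤ s) : f (u, v) + s * f (0, 1) ≤ f (u + s, v) := by
  have hlow := hf.mul_le hsmul hu hv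
  rcases (add_nonneg hu hv).eq_or_lt' with hm | hm
  · obtain ⟨rfl, rfl⟩ : u = 0 ∧ v = 0 := by constructor <;> linarith
    have hzero : f (0, 0) = 0 := by
      have := hsmul 0 (0, 0) le_rfl
      rwa [Prod.smul_mk, smul_zero, zero_mul] at this
    rw [hzero, zero_add, zero_add]
    simpa only [add_zero] using hf.mul_le hsmul hs le_rfl
  · have hscale : f ((1 + s / (u + v)) • (u, v)) ≤ f (u + s, v) := by
      have := hf ((1 + s / (u + v)) * u) ((1 + s / (u + v)) * v) (s / (u + v) * v) (by positivity)
        (by positivity) (by linarith)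
      rwa [show (1 + s / (u + v)) * u + s / (u + v) * v = u + s by field_simp; ring,
        show (1 + s / (u + v)) * v - s / (u + v) * v = v by ring] at this
    rw [hsmul _ _ (by positivity)] at hscale
    calc f (u, v) + s * f (0, 1) = f (u, v) + s / (u + v) * ((u + v) * f (0, 1)) := by
          field_simp
      _ ≤ f (u, v) + s / (u + v) * f (u, v) := by gcongr
      _ ≤ f (u + s, v) := by linarith

variable {N n : ℕ}

theorem optimalValue_nonneg (hn : n ≤ N) (w : ℝ × ℝ) : 0 ≤ optimalValue N n w := by
  induction hn using Nat.decreasingInduction generalizing w with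
  | self => rw [optimalValue_self]
  | of_succ n hn ih =>
    rw [optimalValue_of_lt hn]
    exact add_nonneg (ih _) ((ih _).trans (le_max_right _ _))

theorem optimalValue_smul (hn : n ≤ N) (c : ℝ) (w : ℝ × ℝ) (hc : 0 ≤ c) :
    optimalValue N n (c • w) = c * optimalValue N n w := by
  induction hn using Nat.decreasingInduction generalizing w with
  | self => rw [optimalValue_self, optimalValue_self, mul_zero]
  | of_succ n hn ih =>
    rw [optimalValue_of_lt hn, optimalValue_of_lt hn, map_smul, map_smul, ih, ih, mul_add,
      mul_max_of_nonneg _ _ hc, Prod.smul_fst, Prod.smul_snd, smul_eq_mul, smul_eq_mul, ← mul_add,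
      mul_div_assoc]

theorem optimalValue_add_le (hn : n ≤ N) (w w' : ℝ × ℝ) :
    optimalValue N n (w + w') ≤ optimalValue N n w + optimalValue N n w' := by
  induction hn using Nat.decreasingInduction generalizing w w' with
  | self => simp only [optimalValue_self, add_zero, le_refl]
  | of_succ n hn ih =>
    rw [optimalValue_of_lt hn, optimalValue_of_lt hn, optimalValue_of_lt hn, map_add, map_add,
      add_add_add_comm]
    refine add_le_add (ih _ _) ((max_le_max_left _ (ih _ _)).trans ?_)
    rw [Prod.fst_add, Prod.snd_add, add_add_add_comm, add_div]
    exact max_add_add_le_max_add_max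

theorem optimalValue_noCandidateMass_add_le {a b t : ℝ} (h0 : 0 < n) (hn : n < N)
    (hshift : ShiftMonotone (optimalValue N (n + 1))) (ha : 0 ≤ a) (ht : 0 ≤ t) (htb : t ≤ b) :
    optimalValue N (n + 1) (noCandidateMass n (a, b)) +
        t / (n + 1) * optimalValue N (n + 1) (0, 1) ≤
      optimalValue N (n + 1) (noCandidateMass n (a + t, b - t)) := by
  have hpred : (0 : ℝ) ≤ n - 1 := sub_nonneg.2 (Nat.one_le_cast.2 h0)
  have hb : 0 ≤ b := ht.trans htb
  have hmass : noCandidateMass n (a + t, b - t) =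
      (n / (n + 1) * a + t / (n + 1) + (n - 1) / (n + 1) * t,
        (n - 1) / (n + 1) * b - (n - 1) / (n + 1) * t) := by
    rw [noCandidateMass_apply]
    ext
    · field_simp
      ring
    · ring
  rw [hmass, noCandidateMass_apply]
  exact (hshift.add_mul_le (optimalValue_smul hn) (by positivity) (by positivity)
    (by positivity)).trans (hshift _ _ _ (by positivity) (by positivity) (by gcongr))

theorem optimalValue_candidateMass_le {a b t : ℝ} (hn : n < N) (ht : 0 ≤ t) :
    optimalValue N (n + 1) (candidateMass n (a, b)) ≤
      optimalValue N (n + 1) (candidateMass n (a + t, b - t)) +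
        t / (n + 1) * optimalValue N (n + 1) (0, 1) := by
  have hsplit : candidateMass n (a, b) =
      candidateMass n (a + t, b - t) + (t / (n + 1) : ℝ) • (0, 1) := by
    simp only [candidateMass_apply]
    ext <;> simp only [Prod.smul_mk, Prod.mk_add_mk, smul_eq_mul] <;> ring
  rw [hsplit, ← optimalValue_smul hn _ _ (by positivity)]
  exact optimalValue_add_le hn _ _

/-- Shifting the mass `t` raises the first term of the recursion by at least `t / (n + 1)` times the
value of `(0, 1)`, and lowers the second one by at most that. -/
theorem shiftMonotone_optimalValue (h0 : 0 < n) (hn : n ≤ N) :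
    ShiftMonotone (optimalValue N n) := by
  induction hn using Nat.decreasingInduction with
  | self =>
    intro a b t _ _ _
    rw [optimalValue_self, optimalValue_self]
  | of_succ n hn ih =>
    intro a b t ha ht htb
    have hno := optimalValue_noCandidateMass_add_le h0 hn (ih n.succ_pos) ha ht htb
    have hyes := optimalValue_candidateMass_le (a := a) (b := b) hn ht
    have hgain : 0 ≤ t / (n + 1) * optimalValue N (n + 1) (0, 1) :=
      mul_nonneg (by positivity) (optimalValue_nonneg hn _)
    rw [optimalValue_of_lt hn, optimalValue_of_lt hn, show a + t + (b - t) = a + b by ring]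
    have hmax := max_le_max (le_add_of_nonneg_right (a := (a + b) / N) hgain) hyes
    rw [max_add_add_right] at hmax
    linarith

theorem optimalValue_succ_zero_one_le (h0 : 0 < n) (hn : n < N) :
    optimalValue N (n + 1) (0, 1) ≤ optimalValue N n (0, 1) := by
  have hpred : (0 : ℝ) ≤ n - 1 := sub_nonneg.2 (Nat.one_le_cast.2 h0)
  have hno : noCandidateMass n (0, 1) = ((n - 1) / (n + 1) : ℝ) • (0, 1) := by
    simp [noCandidateMass_apply]
  have hyes : candidateMass n (0, 1) = (1 / (n + 1) : ℝ) • (1, 1) := by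
    simp [candidateMass_apply]
  have hshift := (shiftMonotone_optimalValue n.succ_pos hn).mul_le (optimalValue_smul hn)
    zero_le_one zero_le_one
  rw [optimalValue_of_lt hn (0, 1), hno, hyes, optimalValue_smul hn _ _ (by positivity),
    optimalValue_smul hn _ _ (by positivity)]
  calc optimalValue N (n + 1) (0, 1)
      = (n - 1) / (n + 1) * optimalValue N (n + 1) (0, 1) +
          1 / (n + 1) * ((1 + 1) * optimalValue N (n + 1) (0, 1)) := by
        field_simp
        ring
    _ ≤ (n - 1) / (n + 1) * optimalValue N (n + 1) (0, 1) +
          1 / (n + 1) * optimalValue N (n + 1) (1, 1) := by gcongr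
    _ ≤ _ := by gcongr; exact le_max_right _ _

theorem untakenValue_lt_optimalValue (h0 : 0 < n) (hn : n < N) :
    untakenValue N n < optimalValue N n (0, 1) := by
  have hN : 0 < N := h0.trans hn
  induction hn.le using Nat.decreasingInduction with
  | self => exact absurd hn (lt_irrefl N)
  | of_succ n hlt ih =>
    rw [untakenValue, if_pos hlt]
    rcases (Nat.succ_le_of_lt hlt).eq_or_lt with rfl | hlt'
    · rw [untakenValue, if_neg (lt_irrefl _), optimalValue_of_lt hlt]
      simp only [optimalValue_self, mul_zero, zero_add, add_zero]
      exact lt_max_of_lt_left (by positivity)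
    · refine lt_of_lt_of_le ?_ (optimalValue_succ_zero_one_le h0 hlt)
      calc 1 / (n + 1) * optimalValue N (n + 1) (0, 1) + n / (n + 1) * untakenValue N (n + 1)
          < 1 / (n + 1) * optimalValue N (n + 1) (0, 1) +
              n / (n + 1) * optimalValue N (n + 1) (0, 1) := by
            gcongr
            exact ih n.succ_pos hlt'
        _ = optimalValue N (n + 1) (0, 1) := by field_simp; ring

end Monotonicity

section SecretaryValue

variable {N : ℕ}

theorem secretaryRem_succ (N m : ℕ) : secretaryRem N (m + 1) = secretaryRem N m +
    1 / (((N - (m + 1) : ℕ) : ℝ) + 1) *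
      (max ((((N - (m + 1) : ℕ) : ℝ) + 1) / N) (secretaryRem N m) - secretaryRem N m) := by
  rw [secretaryRem]
  field_simp
  ring

theorem monotone_secretaryRem (N : ℕ) : Monotone (secretaryRem N) := by
  refine monotone_nat_of_le_succ fun m => ?_
  rw [secretaryRem_succ]
  exact le_add_of_nonneg_right
    (mul_nonneg (by positivity) (sub_nonneg.2 (le_max_right _ _)))

theorem secretaryRem_one (hN : 0 < N) : secretaryRem N 1 = 1 / N := by
  have hN' : (N : ℝ) ≠ 0 := Nat.cast_ne_zero.2 hN.ne'
  rw [secretaryRem_succ, secretaryRem, zero_add, Nat.cast_pred hN, sub_add_cancel, div_self hN',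
    max_eq_left zero_le_one, sub_zero, mul_one]

theorem one_div_lt_secretaryRem_two (hN : 3 ≤ N) : 1 / (N : ℝ) < secretaryRem N 2 := by
  have hN' : (3 : ℝ) ≤ N := by exact_mod_cast hN
  rw [secretaryRem_succ, secretaryRem_one (by omega), lt_add_iff_pos_right]
  refine mul_pos (by positivity) (sub_pos.2 (lt_max_of_lt_left ?_))
  rw [Nat.cast_sub (by omega)]
  gcongr
  push_cast
  linarith

theorem secretaryValue_nStar_le (N : ℕ) : secretaryValue N (nStar N) ≤ nStar N / N := by
  refine Nat.sInf_mem (s := {n : ℕ | secretaryValue N n ≤ (n : ℝ) / N}) ⟨N, ?_⟩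
  rw [Set.mem_ofPred_eq, secretaryValue, Nat.sub_self, secretaryRem]
  positivity

theorem nStar_pos (hN : 0 < N) : 0 < nStar N := by
  refine Nat.pos_of_ne_zero fun h0 => ?_
  have hle := secretaryValue_nStar_le N
  rw [h0, secretaryValue, Nat.cast_zero, zero_div, Nat.sub_zero] at hle
  have hpos : 0 < secretaryRem N 1 := secretaryRem_one hN ▸ by positivity
  exact (hpos.trans_le (monotone_secretaryRem N hN)).not_ge hle

theorem one_lt_nStar (hN : 3 ≤ N) : 1 < nStar N := by
  refine (Nat.succ_le_of_lt (nStar_pos (by omega))).lt_of_ne fun h1 => ?_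
  have hle := secretaryValue_nStar_le N
  rw [← h1, secretaryValue, Nat.cast_one] at hle
  have hmono : secretaryRem N 2 ≤ secretaryRem N (N - 1) :=
    monotone_secretaryRem N (Nat.le_sub_one_of_lt hN)
  exact ((one_div_lt_secretaryRem_two hN).trans_le hmono).not_ge hle

end SecretaryValue

/-- The order obtained from `σ` by making the object `a` the best one and keeping the relative order
of all the other objects. -/
def promote {N : ℕ} (a : Fin N) (σ : Equiv.Perm (Fin N)) : Equiv.Perm (Fin N) :=
  σ.trans (Fin.cycleRange (σ a))

section Promote

variable {N : ℕ} {σ : Equiv.Perm (Fin N)} {i j k a : Fin N}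

theorem promote_apply_lt_promote_apply_iff (hj : j ≠ a) (hk : k ≠ a) :
    promote a σ j < promote a σ k ↔ σ j < σ k := by
  have hval (i : Fin N) (hi : i ≠ a) :
      (promote a σ i).val = if (σ i).val < (σ a).val then (σ i).val + 1 else (σ i).val := by
    rcases (σ.injective.ne hi).lt_or_gt with h | h
    · rw [if_pos (Fin.lt_def.1 h)]
      exact Fin.coe_cycleRange_of_lt h
    · rw [if_neg (Fin.lt_def.1 h).not_gt]
      exact congrArg Fin.val (Fin.cycleRange_of_gt h)
  have hka := Fin.val_ne_of_ne (σ.injective.ne hk)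
  rw [Fin.lt_def, Fin.lt_def, hval j hj, hval k hk]
  split_ifs <;> omega

theorem promote_apply_self_lt (σ : Equiv.Perm (Fin N)) (hj : j ≠ a) :
    promote a σ a < promote a σ j := by
  have : NeZero N := ⟨a.pos.ne'⟩
  refine lt_of_le_of_ne ?_ ((promote a σ).injective.ne hj.symm)
  rw [promote, Equiv.trans_apply, Fin.cycleRange_self]
  exact Fin.zero_le _

theorem sameOrder_promote (σ : Equiv.Perm (Fin N)) (a : Fin N) :
    SameOrder a.val σ (promote a σ) := fun _ _ hj hk =>
  (promote_apply_lt_promote_apply_iff (Fin.ne_of_lt hj) (Fin.ne_of_lt hk)).symm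

theorem numBetter_promote_self (σ : Equiv.Perm (Fin N)) (a : Fin N) :
    numBetter (promote a σ) a = 0 :=
  numBetter_eq_zero_iff.2 fun _ hj => promote_apply_self_lt σ hj.ne

theorem PlayerOneAccepts.promote (ha : PlayerOneAccepts σ a) :
    PlayerOneAccepts (promote a σ) a := by
  have h0 : numBetter σ a = 0 := numBetter_eq_zero_iff.2 fun _ => ha.lt_of_lt
  have hs := (sameOrder_promote σ a).succ (h0.trans (numBetter_promote_self σ a).symm)
  exact (hs.playerOneAccepts_iff (Nat.lt_succ_self _)).1 ha

theorem PlayerOneAccepts.isCandidate_promote_iff (ha : PlayerOneAccepts σ a) :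
    IsCandidate (_root_.promote a σ) i ↔ IsCandidate σ i := by
  rw [ha.promote.isCandidate_iff, ha.isCandidate_iff]
  exact and_congr_right fun hi => forall₂_congr fun j _ => imp_congr_right fun hj =>
    promote_apply_lt_promote_apply_iff hi hj

end Promote

section Histories

variable {N : ℕ} {σ : Equiv.Perm (Fin N)} {h : Finset (Fin N)} {i : Fin N}

theorem exists_playerOneAccepts_of_isCandidate (hn : nStar N ≤ i.val + 1) (hc : IsCandidate σ i) :
    ∃ a < i, PlayerOneAccepts σ a := by
  by_contra! hno
  exact not_isCandidate_of_not_playerOneAccepts hn hno hc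

theorem mem_state_of_mem_historyEvent (hn : nStar N ≤ i.val + 1) (hσ : σ ∈ historyEvent i h) :
    relRank σ i = 1 ∧ σ ∈ beatenState (i.val + 1) h ∨
      relRank σ i = 2 ∧ σ ∈ leadingState (i.val + 1) h := by
  obtain ⟨hc, hh⟩ := hσ
  obtain ⟨a, hai, ha⟩ := exists_playerOneAccepts_of_isCandidate hn hc
  rw [history_eq_candidatesBefore, hc.candidatesBefore_succ] at hh
  rw [relRank_eq_numBetter_add_one, ← hh]
  rcases eq_or_ne (numBetter σ i) 0 with h0 | h0
  · exact Or.inl ⟨by rw [h0], mem_beatenState_succ_of_best hai ha h0⟩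
  · have hlead := (mem_beatenState_or_mem_leadingState hai ha).resolve_left fun hbeaten =>
      h0 ((isCandidate_iff_of_mem_beatenState hbeaten).1 hc)
    have h1 : numBetter σ i = 1 := ((isCandidate_iff_of_mem_leadingState hlead).1 hc).antisymm
      (Nat.one_le_iff_ne_zero.2 h0)
    exact Or.inr ⟨by rw [h1], mem_leadingState_succ_insert hlead h1⟩

theorem historyRankEvent_one_subset (hn : nStar N ≤ i.val + 1) :
    historyRankEvent i h 1 ⊆ beatenState (i.val + 1) h := fun _ ⟨hσ, hr⟩ =>
  ((mem_state_of_mem_historyEvent hn hσ).resolve_right fun h2 => by omega).2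

theorem historyRankEvent_two_subset (hn : nStar N ≤ i.val + 1) :
    historyRankEvent i h 2 ⊆ leadingState (i.val + 1) h := fun _ ⟨hσ, hr⟩ =>
  ((mem_state_of_mem_historyEvent hn hσ).resolve_left fun h1 => by omega).2

theorem historyRankEvent_two_eq_sdiff (hn : nStar N ≤ i.val + 1) :
    historyRankEvent i h 2 = historyEvent i h \ {σ | relRank σ i = 1} := by
  ext σ
  refine and_congr_right fun hσ => ?_
  have := mem_state_of_mem_historyEvent hn hσ
  rw [Set.mem_ofPred_eq]
  omega

theorem historyRankEvent_one_nonempty (hn : nStar N ≤ i.val + 1)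
    (hne : (historyEvent i h).Nonempty) : (historyRankEvent i h 1).Nonempty := by
  obtain ⟨σ, hc, rfl⟩ := hne
  obtain ⟨a, hai, ha⟩ := exists_playerOneAccepts_of_isCandidate hn hc
  have hs := sameOrder_promote σ i
  have hc' : IsCandidate (promote i σ) i := ((hs.playerOneAccepts_iff hai).1 ha).isCandidate_iff.2
    ⟨hai.ne', fun j hj _ => promote_apply_self_lt σ hj.ne⟩
  refine ⟨promote i σ, ⟨hc', ?_⟩, ?_⟩
  · rw [history_eq_candidatesBefore, history_eq_candidatesBefore, hc.candidatesBefore_succ,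
      hc'.candidatesBefore_succ, hs.candidatesBefore_eq]
  · rw [relRank_eq_numBetter_add_one, numBetter_promote_self]

/-- Promoting Player 1's object does not affect what Player 2 sees. -/
theorem historyRankEvent_two_nonempty (hn : nStar N ≤ i.val + 1)
    (hne : (historyEvent i h).Nonempty) : (historyRankEvent i h 2).Nonempty := by
  obtain ⟨σ, hc, hh⟩ := hne
  obtain ⟨a, hai, ha⟩ := exists_playerOneAccepts_of_isCandidate hn hc
  have hmem : promote a σ ∈ historyEvent i h := by
    refine ⟨ha.isCandidate_promote_iff.2 hc, ?_⟩
    rw [← hh, history_eq_candidatesBefore, history_eq_candidatesBefore]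
    ext j
    rw [mem_candidatesBefore, mem_candidatesBefore, ha.isCandidate_promote_iff]
  have hworse : numBetter (promote a σ) i ≠ 0 :=
    numBetter_ne_zero_iff.2 ⟨a, hai, promote_apply_self_lt σ hai.ne'⟩
  rw [historyRankEvent_two_eq_sdiff hn]
  refine ⟨_, hmem, fun h1 => hworse ?_⟩
  rw [Set.mem_ofPred_eq, relRank_eq_numBetter_add_one] at h1
  exact Nat.succ_injective h1

theorem determined_historyRankEvent (i : Fin N) (h : Finset (Fin N)) (r : ℕ) :
    Determined (i.val + 1) (historyRankEvent i h r) := by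
  rintro σ σ' hs ⟨⟨hc, rfl⟩, rfl⟩
  refine ⟨⟨(hs.isCandidate_iff (Nat.lt_succ_self _)).1 hc, ?_⟩,
    (hs.relRank_eq (Nat.lt_succ_self _)).symm⟩
  rw [history_eq_candidatesBefore, history_eq_candidatesBefore, hs.candidatesBefore_eq]

theorem lt_succ_of_historyEvent_nonempty (hne : (historyEvent i h).Nonempty) :
    ∀ j ∈ h, j.val < i.val + 1 := by
  obtain ⟨σ, -, rfl⟩ := hne
  intro j hj
  rw [history_eq_candidatesBefore, mem_candidatesBefore] at hj
  exact hj.1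

theorem beliefValue_eq_optimalValue (hn : nStar N ≤ i.val + 1) (hne : (historyEvent i h).Nonempty)
    (p : ℝ) : beliefValue i h p = optimalValue N (i.val + 1) (p, 1 - p) := by
  rw [← iSup_payoff i.is_lt (lt_succ_of_historyEvent_nonempty hne), beliefValue]
  refine iSup_congr fun τ => ?_
  have hone := (hasCondProb_beatenState τ i.is_lt h).condProb_eq (historyRankEvent_one_subset hn)
    (determined_historyRankEvent i h 1) (historyRankEvent_one_nonempty hn hne)
  have htwo := (hasCondProb_leadingState τ i.val.succ_pos i.is_lt h).condProb_eq
    (historyRankEvent_two_subset hn) (determined_historyRankEvent i h 2)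
    (historyRankEvent_two_nonempty hn hne)
  have hmix : (p, 1 - p) = p • ((1, 0) : ℝ × ℝ) + (1 - p) • (0, 1) := by simp
  rw [hone, htwo, hmix, map_add, map_smul, map_smul, smul_eq_mul, smul_eq_mul]

theorem historyValue_eq_beliefValue (hn : nStar N ≤ i.val + 1) (h : Finset (Fin N)) :
    historyValue i h = beliefValue i h (posterior i h) :=
  iSup_congr fun τ => by
    rw [historyRankEvent_two_eq_sdiff hn]
    exact condProb_eq_add _ _ _

end Histories

section CandidatesBefore

variable {N n : ℕ} {E W : Set (Equiv.Perm (Fin N))} {x : Finset (Fin N) → ℝ} {c : ℝ}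

theorem determined_candidatesBefore (n : ℕ) (h : Finset (Fin N)) :
    Determined n {σ : Equiv.Perm (Fin N) | candidatesBefore σ n = h} :=
  fun _ _ hs hσ => hs.candidatesBefore_eq.symm.trans hσ

theorem ncard_eq_sum_candidatesBefore (E : Set (Equiv.Perm (Fin N))) (n : ℕ) :
    (E.ncard : ℝ) = ∑ h ∈ ({j : Fin N | j.val < n} : Finset (Fin N)).powerset,
      ((E ∩ {σ | candidatesBefore σ n = h}).ncard : ℝ) := by
  rw [← Nat.cast_sum]
  refine congrArg _ (ncard_eq_sum_ncard_fiber E.toFinite fun σ _ => ?_)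
  exact Finset.mem_powerset.2 fun j hj =>
    Finset.mem_filter.2 ⟨Finset.mem_univ j, (mem_candidatesBefore.1 hj).1⟩

theorem Determined.ncard_inter_eq_sum (hE : Determined n E)
    (hx : ∀ h, HasCondProb n (E ∩ {σ | candidatesBefore σ n = h}) W (x h)) :
    ((W ∩ E).ncard : ℝ) = ∑ h ∈ ({j : Fin N | j.val < n} : Finset (Fin N)).powerset,
      x h * (E ∩ {σ | candidatesBefore σ n = h}).ncard := by
  rw [ncard_eq_sum_candidatesBefore _ n]
  refine Finset.sum_congr rfl fun h _ => ?_
  rw [Set.inter_assoc, hx h _ subset_rfl (hE.inter (determined_candidatesBefore n h))]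

theorem Determined.condProb_le (hE : Determined n E) (hc : 0 ≤ c)
    (hx : ∀ h, HasCondProb n (E ∩ {σ | candidatesBefore σ n = h}) W (x h)) (hle : ∀ h, x h ≤ c) :
    condProb W E ≤ c := by
  refine div_le_of_le_mul₀ (Nat.cast_nonneg _) hc ?_
  rw [hE.ncard_inter_eq_sum hx, ncard_eq_sum_candidatesBefore E n, Finset.mul_sum]
  gcongr
  exact hle _

theorem Determined.condProb_eq (hE : Determined n E) (hne : E.Nonempty)
    (hx : ∀ h, HasCondProb n (E ∩ {σ | candidatesBefore σ n = h}) W (x h))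
    (heq : ∀ h : Finset (Fin N), (∀ j ∈ h, j.val < n) → x h = c) : condProb W E = c := by
  rw [condProb, div_eq_iff (Nat.cast_ne_zero.2 ((Set.ncard_pos E.toFinite).2 hne).ne'),
    hE.ncard_inter_eq_sum hx, ncard_eq_sum_candidatesBefore E n, Finset.mul_sum]
  refine Finset.sum_congr rfl fun h hh => ?_
  rw [heq h fun j hj => (Finset.mem_filter.1 (Finset.mem_powerset.1 hh hj)).2]

end CandidatesBefore

/-- Player 1 has accepted one of the first `n` objects and no candidate according to Player 2 has
appeared from moment `n*` to moment `n`: the event of `valueZero`. -/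
def noCandidateEvent (N n : ℕ) : Set (Equiv.Perm (Fin N)) :=
  {σ | (∃ i : Fin N, i.val < n ∧ PlayerOneAccepts σ i) ∧
    ∀ j : Fin N, nStar N ≤ j.val + 1 → j.val < n → ¬ IsCandidate σ j}

section WithoutCandidates

variable {N n : ℕ}

theorem determined_noCandidateEvent (N n : ℕ) : Determined n (noCandidateEvent N n) := by
  rintro σ σ' hs ⟨⟨a, ha, hp⟩, hc⟩
  exact ⟨⟨a, ha, (hs.playerOneAccepts_iff ha).1 hp⟩,
    fun j hj hjn => (hs.isCandidate_iff hjn).not.1 (hc j hj hjn)⟩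

theorem noCandidateEvent_inter_subset (n : ℕ) (h : Finset (Fin N)) :
    noCandidateEvent N n ∩ {σ | candidatesBefore σ n = h} ⊆ leadingState n h := by
  rintro σ ⟨⟨⟨a, ha, hp⟩, hc⟩, hh⟩
  refine ⟨hh, a, ha, hp, fun j => ?_⟩
  induction j using WellFoundedLT.induction with
  | ind j ih =>
    intro hj
    rcases le_or_gt j a with hja | haj
    · exact hp.le_of_le hja
    · by_contra! hlt
      have hstar : nStar N ≤ j.val + 1 := hp.1.1.trans (Nat.succ_le_succ haj.le)
      exact hc j hstar hj <| hp.isCandidate_iff.2 ⟨haj.ne', fun k hk _ =>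
        hlt.trans_le (ih k hk (lt_trans hk hj))⟩

/-- The object at moment `n*` is the best one and the others appear from best to worst. -/
theorem noCandidateEvent_nonempty (h1 : 1 < nStar N) (hn : nStar N ≤ n) (hN : n ≤ N) :
    (noCandidateEvent N n).Nonempty := by
  let z : Fin N := ⟨0, by omega⟩
  let s : Fin N := ⟨nStar N - 1, by omega⟩
  have hs : s.val + 1 = nStar N := Nat.sub_add_cancel h1.le
  have hzs : z < s := Nat.sub_pos_of_lt h1
  have hp : PlayerOneAccepts (promote s 1) s := by
    refine ⟨⟨hs.ge, ?_⟩, fun j hj hcon => ?_⟩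
    · rw [relRank_eq_numBetter_add_one, numBetter_promote_self]
    · exact (Nat.succ_lt_succ hj).not_ge (hs.le.trans hcon.1)
  refine ⟨promote s 1, ⟨s, by omega, hp⟩, fun j hj _ hc => ?_⟩
  obtain ⟨hjs, hbest⟩ := hp.isCandidate_iff.1 hc
  have hsj : s < j := lt_of_le_of_ne (Nat.succ_le_succ_iff.1 (hs.le.trans hj)) hjs.symm
  have hzj : z < j := hzs.trans hsj
  exact hzj.asymm ((promote_apply_lt_promote_apply_iff hjs hzs.ne).1 (hbest z hzj hzs.ne))

theorem hasCondProb_noCandidateEvent (τ : Strategy N) (h0 : 0 < n) (hn : n ≤ N)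
    (h : Finset (Fin N)) : HasCondProb n (noCandidateEvent N n ∩ {σ | candidatesBefore σ n = h})
      {σ | Wins τ n σ} (payoff τ n h (0, 1)) :=
  (hasCondProb_leadingState τ h0 hn h).mono (noCandidateEvent_inter_subset n h)

theorem valueZero_eq_optimalValue (hn : nStar N < n) (hN : n ≤ N) :
    valueZero N n = optimalValue N n (0, 1) := by
  change ⨆ τ : Strategy N, condProb {σ | Wins τ n σ} (noCandidateEvent N n) = _
  rcases hN.eq_or_lt with rfl | hlt
  · simp [condProb, not_wins_self, optimalValue_self]
  have h0 : 0 < n := Nat.zero_lt_of_lt hn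
  have hstar := nStar_pos (h0.trans hlt)
  have hne := noCandidateEvent_nonempty (one_lt_nStar (by omega)) hn.le hN
  refine IsLUB.ciSup_eq <| IsGreatest.isLUB
    ⟨⟨greedyStrategy N n (0, 1), ?_⟩, Set.forall_mem_range.2 fun τ => ?_⟩
  · exact (determined_noCandidateEvent N n).condProb_eq hne
      (hasCondProb_noCandidateEvent _ h0 hN) fun h hh => payoff_greedyStrategy hN hh
  · exact (determined_noCandidateEvent N n).condProb_le (optimalValue_nonneg hN _)
      (hasCondProb_noCandidateEvent τ h0 hN) fun h => payoff_le_optimalValue τ hN h _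

theorem untakenValue_nonneg (hn : n ≤ N) : 0 ≤ untakenValue N n := by
  induction hn using Nat.decreasingInduction with
  | self => rw [untakenValue, if_neg (lt_irrefl N)]
  | of_succ n hn ih =>
    have := optimalValue_nonneg hn (0, 1)
    rw [untakenValue, if_pos hn]
    positivity

theorem valueNegOne_le_untakenValue (hn : nStar N ≤ n + 1) (hN : n ≤ N) :
    valueNegOne N n ≤ untakenValue N n := by
  refine ciSup_le fun τ => ?_
  have hdet : Determined n {σ : Equiv.Perm (Fin N) | ∀ i, i.val < n → ¬ PlayerOneAccepts σ i} :=
    fun σ σ' hs hσ i hi => (hs.playerOneAccepts_iff hi).not.1 (hσ i hi)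
  exact hdet.condProb_le (untakenValue_nonneg hN)
    (fun h => (hasCondProb_untakenState τ hn hN h).mono fun σ hσ => ⟨hσ.2, hσ.1⟩)
    fun h => untakenPayoff_le_untakenValue τ hN h

end WithoutCandidates

theorem theorem1 (N : ℕ) :
    ∃ v : ℕ → ℝ → ℝ,
      -- `v(n, p)` is Player 2's optimal payoff after rejecting a candidate at moment `n > n*`,
      -- where `p` is the posterior probability that this candidate has relative rank 1
      (∀ (i : Fin N) (h : Finset (Fin N)), nStar N < i.val + 1 → (historyEvent i h).Nonempty →
        historyValue i h = v (i.val + 1) (posterior i h) ∧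
        ∀ p ∈ Set.Icc (0 : ℝ) 1, beliefValue i h p = v (i.val + 1) p) ∧
      (∀ n : ℕ, nStar N < n → n ≤ N → valueZero N n = v n 0) ∧
      (∀ n : ℕ, nStar N < n → n ≤ N → MonotoneOn (v n) (Set.Icc 0 1)) ∧
      (∀ n : ℕ, nStar N < n → n < N → valueNegOne N n < v n 0) := by
  refine ⟨fun n p => optimalValue N n (p, 1 - p), fun i h hi hne => ?_, fun n hn hN => ?_,
    fun n hn hN => ?_, fun n hn hN => ?_⟩
  · have hbelief := beliefValue_eq_optimalValue hi.le hne
    exact ⟨(historyValue_eq_beliefValue hi.le h).trans (hbelief _), fun p _ => hbelief p⟩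
  · simp only [sub_zero]
    exact valueZero_eq_optimalValue hn hN
  · exact (shiftMonotone_optimalValue (Nat.zero_lt_of_lt hn) hN).monotoneOn
  · simp only [sub_zero]
    exact (valueNegOne_le_untakenValue (hn.le.trans (Nat.le_succ n)) hN.le).trans_lt
      (untakenValue_lt_optimalValue (Nat.zero_lt_of_lt hn) hN)
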